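/- Let $A$ be a finite alphabet with the discrete topology and let $\sigma\colon A^*\to A^*$ be an endomorphism of the free monoid $A^*$, where $\sigma(a)$ is allowed to be the empty word for some letters $a$. For $x\in A^{\mathbb Z}$, let $\mathcal L(x)$ denote the set of all finite factors of $x$. Let $\mathcal L(\sigma)$ be the set of all factors of the words $\sigma^n(a)$ with $n\ge 0$ and $a\in A$, and let $\mathsf X(\sigma)$ be the shift space of all $x\in A^{\mathbb Z}$ with $\mathcal L(x)\subseteq\mathcal L(\sigma)$. A shift space is a closed subset $Y$ of $A^{\mathbb Z}$ that satisfies $S(Y)=Y$, where $S$ is the shift; it is quasi-minimal if it contains only finitely many shift spaces. Then $\mathsf X(\sigma)$ is quasi-minimal, that is, the set of shift spaces $Y\subseteq \mathsf X(\sigma)$ is finite; equivalently, the set of languages $\{\mathcal L(x)\mid x\in \mathsf X(\sigma)\}$ is finite, and this holds as well. -/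

import Mathlib

open SymbolicDynamics.FullShift

namespace SubstShift

variable {A : Type*}

/-- The word `x_i x_{i+1} ⋯ x_{i+n-1}` of the two-sided infinite sequence `x`. -/
def block (x : ℤ → A) (i : ℤ) (n : ℕ) : List A :=
  List.ofFn fun k : Fin n => x (i + (k : ℤ))

/-- The language `L(x)`: the set of all (finite) factors of the sequence `x`. -/
def seqLanguage (x : ℤ → A) : Set (List A) :=
  {w | ∃ (i : ℤ) (n : ℕ), w = block x i n}

/-- The language `L(σ)` of an endomorphism of `A^*`: all factors of the words `σ^n(a)`,
for `n ≥ 0` and `a ∈ A`. Letters may be erased by `σ`. -/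
def endLanguage (σ : Monoid.End (FreeMonoid A)) : Set (List A) :=
  {w | ∃ (n : ℕ) (a : A), w <:+: FreeMonoid.toList ((σ ^ n) (FreeMonoid.of a))}

/-- The shift `X(σ)`: all two-sided infinite sequences whose factors all lie in `L(σ)`. -/
def substitutionShift [TopologicalSpace A] [DiscreteTopology A]
    (σ : Monoid.End (FreeMonoid A)) : Subshift A ℤ where
  carrier := {x | seqLanguage x ⊆ endLanguage σ}
  isClosed := by
    have h : {x : ℤ → A | seqLanguage x ⊆ endLanguage σ} =
        ⋂ (i : ℤ) (n : ℕ), (fun (x : ℤ → A) (k : Fin n) => x (i + (k : ℤ))) ⁻¹'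
          {u | List.ofFn u ∈ endLanguage σ} := by
      ext x
      simp only [Set.mem_ofPred_eq, Set.mem_iInter, Set.mem_preimage]
      constructor
      · intro hx i n
        exact hx ⟨i, n, rfl⟩
      · rintro hx w ⟨i, n, rfl⟩
        exact hx i n
    rw [h]
    refine isClosed_iInter fun i => isClosed_iInter fun n => ?_
    refine IsClosed.preimage ?_ (isClosed_discrete _)
    exact continuous_pi fun k => continuous_apply _
  mapsTo := by
    rintro g x hx w ⟨i, n, rfl⟩
    refine hx ⟨g + i, n, ?_⟩
    simp only [block, shift_apply, add_assoc]

/-- A shift space is quasi-minimal if it has only finitely many subshifts. -/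
def QuasiMinimal [TopologicalSpace A] (X : Subshift A ℤ) : Prop :=
  {Y : Subshift A ℤ | Y.carrier ⊆ X.carrier}.Finite

end SubstShift

/-!
A subshift is determined by the languages of its points, so quasi-minimality follows once the points
of `X(σ)` are known to have finitely many languages.

Replace `σ` by a power `τ` that is idempotent on the letters whose iterated images have bounded
length. Every point is the image under `τ` of a sequence without erased letters, whose language
determines that of the point. On such sequences `τ` induces a nonerasing morphism under which each
letter may be taken to be fixed or to produce moving (non-fixed) letters forever. Adjoin a letter
`e ↦ e w e` for each initial word `w`, so that all factors come from the iterated images of one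
letter, and pass to a power under which the maps taking a moving letter to the first and to the last
moving letter of its image are idempotent.

For the resulting morphism, the words between consecutive moving letters have the form `v^k z u^k`,
with finitely many choices of `u`, `v`, `z`, which leaves finitely many languages of points without
moving letters. Any other point can be desubstituted infinitely often around a moving letter at the
origin. Consider the increasing intervals covered by the iterated images of the letters found there.
If they exhaust `ℤ`, a letter that recurs at the origin generates the language. If they are bounded
on the right or, by symmetry, on the left, the letter at the origin is eventually constant, and the
language is generated by that letter and its neighbourhood up to the next moving letter, which takes
finitely many forms.
-/

namespace SubstShift

open Filter

section Occurrences

variable {A : Type*} {x : ℤ → A} {i j : ℤ} {u v w : List A}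

@[simp] theorem length_block (x : ℤ → A) (i : ℤ) (n : ℕ) : (block x i n).length = n := by
  simp [block]

@[simp] theorem getElem_block (x : ℤ → A) (i : ℤ) (n k : ℕ) (h : k < (block x i n).length) :
    (block x i n)[k] = x (i + k) := by
  simp [block]

@[simp] theorem block_zero (x : ℤ → A) (i : ℤ) : block x i 0 = [] := by
  simp [block]

@[simp] theorem block_one (x : ℤ → A) (i : ℤ) : block x i 1 = [x i] := by
  simp [block]

theorem block_add (x : ℤ → A) (i : ℤ) (m n : ℕ) :
    block x i (m + n) = block x i m ++ block x (i + m) n := by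
  simp [block, List.ofFn_add, add_assoc]

theorem block_succ (x : ℤ → A) (i : ℤ) (n : ℕ) :
    block x i (n + 1) = x i :: block x (i + 1) n := by
  rw [add_comm, block_add]
  simp

/-- The word `w` occurs in `x` at position `i`. -/
def Occurs (x : ℤ → A) (i : ℤ) (w : List A) : Prop :=
  block x i w.length = w

theorem occurs_block (x : ℤ → A) (i : ℤ) (n : ℕ) : Occurs x i (block x i n) := by
  simp [Occurs]

@[simp] theorem occurs_nil (x : ℤ → A) (i : ℤ) : Occurs x i [] := by
  simp [Occurs]

theorem occurs_append : Occurs x i (u ++ v) ↔ Occurs x i u ∧ Occurs x (i + u.length) v := by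
  unfold Occurs
  rw [List.length_append, block_add]
  exact ⟨fun h => List.append_inj h (by simp), fun h => by rw [h.1, h.2]⟩

theorem occurs_cons {a : A} : Occurs x i (a :: w) ↔ x i = a ∧ Occurs x (i + 1) w := by
  simp [Occurs, block_succ]

@[simp] theorem occurs_singleton {a : A} : Occurs x i [a] ↔ x i = a := by
  simp [Occurs]

theorem mem_seqLanguage : w ∈ seqLanguage x ↔ ∃ i, Occurs x i w := by
  constructor
  · rintro ⟨i, n, rfl⟩
    exact ⟨i, occurs_block x i n⟩
  · rintro ⟨i, h⟩
    exact ⟨i, w.length, h.symm⟩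

theorem Occurs.mem_seqLanguage (h : Occurs x i w) : w ∈ seqLanguage x :=
  SubstShift.mem_seqLanguage.2 ⟨i, h⟩

theorem Occurs.infix_of_le (hw : Occurs x i w) (hu : Occurs x j u) (hij : i ≤ j)
    (hle : j + u.length ≤ i + w.length) : u <:+: w := by
  obtain ⟨p, rfl⟩ := Int.le.dest hij
  obtain ⟨q, hq⟩ := Int.le.dest hle
  have hlen : w.length = p + u.length + q := by omega
  unfold Occurs at hw hu
  rw [hlen, block_add, block_add, hu] at hw
  exact ⟨_, _, hw⟩

theorem infix_block {m n : ℕ} (hij : i ≤ j) (hle : j + m ≤ i + n) :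
    block x j m <:+: block x i n :=
  (occurs_block x i n).infix_of_le (occurs_block x j m) hij (by simpa using hle)

theorem Occurs.mem_of_lt (h : Occurs x i w) (hij : i ≤ j) (hj : j < i + w.length) : x j ∈ w :=
  List.singleton_infix_iff _ _ |>.1 <| h.infix_of_le (occurs_singleton.2 rfl) hij <| by
    simpa using hj

theorem Occurs.prefix_of_le (hw : Occurs x i w) (hu : Occurs x i u)
    (hle : u.length ≤ w.length) : u <+: w := by
  obtain ⟨q, hq⟩ := Nat.exists_eq_add_of_le hle
  unfold Occurs at hw hu
  rw [hq, block_add, hu] at hw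
  exact ⟨_, hw⟩

theorem Occurs.of_prefix (hw : Occurs x i w) (hu : u <+: w) : Occurs x i u := by
  obtain ⟨q, rfl⟩ := hu
  exact (occurs_append.1 hw).1

end Occurrences

section Factorial

variable {A : Type*} {L : Set (List A)} {x : ℤ → A}

/-- A language is factorial if it contains all factors of its words. -/
def IsFactorial (L : Set (List A)) : Prop :=
  ∀ ⦃w⦄, w ∈ L → ∀ ⦃u⦄, u <:+: w → u ∈ L

theorem isFactorial_seqLanguage (x : ℤ → A) : IsFactorial (seqLanguage x) := by
  rintro w hw u ⟨p, q, rfl⟩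
  obtain ⟨i, hi⟩ := mem_seqLanguage.1 hw
  rw [occurs_append, occurs_append] at hi
  exact hi.1.2.mem_seqLanguage

theorem isFactorial_setOf_infix {ι : Sort*} (f : ι → List A) :
    IsFactorial {t | ∃ i, t <:+: f i} := by
  rintro t ⟨i, hi⟩ t' ht'
  exact ⟨i, ht'.trans hi⟩

theorem IsFactorial.seqLanguage_subset (hL : IsFactorial L)
    (h : ∃ᶠ n : ℕ in atTop, block x (-n) (n + n) ∈ L) : seqLanguage x ⊆ L := by
  rintro _ ⟨i, m, rfl⟩
  obtain ⟨n, hn, hmem⟩ := frequently_atTop.1 h (i.natAbs + m)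
  exact hL hmem (infix_block (by omega) (by omega))

theorem exists_frequently_of_finite {ι β : Type*} [Finite β] {l : Filter ι} {p : β → ι → Prop}
    (h : ∃ᶠ i in l, ∃ b, p b i) : ∃ b, ∃ᶠ i in l, p b i := by
  contrapose! h
  simpa only [not_frequently, not_exists, eventually_all] using h

theorem exists_seqLanguage_subset {β : Type*} [Finite β] {K : β → Set (List A)}
    (hK : ∀ b, IsFactorial (K b)) (h : seqLanguage x ⊆ ⋃ b, K b) : ∃ b, seqLanguage x ⊆ K b := by
  obtain ⟨b, hb⟩ := exists_frequently_of_finite (l := atTop)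
    (p := fun b (n : ℕ) => block x (-n) (n + n) ∈ K b)
    (Frequently.of_forall fun n => Set.mem_iUnion.1 (h ⟨_, _, rfl⟩))
  exact ⟨b, (hK b).seqLanguage_subset hb⟩

theorem seqLanguage_subset_or {K₁ K₂ : Set (List A)} (h₁ : IsFactorial K₁)
    (h₂ : IsFactorial K₂) (h : seqLanguage x ⊆ K₁ ∪ K₂) :
    seqLanguage x ⊆ K₁ ∨ seqLanguage x ⊆ K₂ := by
  rw [Set.union_eq_iUnion] at h
  obtain ⟨b | b, hb⟩ := exists_seqLanguage_subset (by rintro (_ | _) <;> assumption) h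
  · exact Or.inr hb
  · exact Or.inl hb

end Factorial

section WordMap

variable {A B C : Type*}

/-- The morphism of free monoids extending the map `s` on letters. -/
def wordMap (s : A → List B) (w : List A) : List B :=
  w.flatMap s

@[simp] theorem wordMap_nil (s : A → List B) : wordMap s [] = [] := rfl

@[simp] theorem wordMap_append (s : A → List B) (u v : List A) :
    wordMap s (u ++ v) = wordMap s u ++ wordMap s v :=
  List.flatMap_append

@[simp] theorem wordMap_cons (s : A → List B) (a : A) (w : List A) :
    wordMap s (a :: w) = s a ++ wordMap s w :=
  List.flatMap_cons

theorem mem_wordMap {s : A → List B} {w : List A} {b : B} :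
    b ∈ wordMap s w ↔ ∃ a ∈ w, b ∈ s a :=
  List.mem_flatMap

theorem wordMap_congr {s t : A → List B} {w : List A} (h : ∀ a ∈ w, s a = t a) :
    wordMap s w = wordMap t w :=
  List.flatMap_congr h

theorem wordMap_wordMap (s : B → List C) (t : A → List B) (w : List A) :
    wordMap s (wordMap t w) = wordMap (fun a => wordMap s (t a)) w :=
  List.flatMap_assoc

theorem length_le_length_wordMap {s : A → List B} (hs : ∀ a, s a ≠ []) (w : List A) :
    w.length ≤ (wordMap s w).length := by
  induction w with
  | nil => simp
  | cons a w ih =>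
    have := List.length_pos_iff.2 (hs a)
    simp only [wordMap_cons, List.length_cons, List.length_append]
    omega

theorem length_wordMap_le {s : A → List B} {M : ℕ} (hM : ∀ a, (s a).length ≤ M) (w : List A) :
    (wordMap s w).length ≤ M * w.length := by
  induction w with
  | nil => simp
  | cons a w ih =>
    have := hM a
    simp only [wordMap_cons, List.length_cons, List.length_append]
    rw [Nat.mul_succ]
    omega

theorem iterate_wordMap_append (s : A → List A) (n : ℕ) (u v : List A) :
    (wordMap s)^[n] (u ++ v) = (wordMap s)^[n] u ++ (wordMap s)^[n] v := by
  induction n generalizing u v with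
  | zero => rfl
  | succ n ih => simp [ih]

@[simp] theorem iterate_wordMap_nil (s : A → List A) (n : ℕ) : (wordMap s)^[n] [] = [] :=
  Function.iterate_fixed (wordMap_nil s) n

theorem iterate_wordMap_infix (s : A → List A) (n : ℕ) {u w : List A} (h : u <:+: w) :
    (wordMap s)^[n] u <:+: (wordMap s)^[n] w := by
  obtain ⟨p, q, rfl⟩ := h
  exact ⟨(wordMap s)^[n] p, (wordMap s)^[n] q, by simp [iterate_wordMap_append]⟩

theorem iterate_wordMap_eq (s : A → List A) (n : ℕ) :
    (wordMap s)^[n] = wordMap fun a => (wordMap s)^[n] [a] := by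
  funext w
  induction w with
  | nil => simp
  | cons a w ih =>
    rw [← List.singleton_append, iterate_wordMap_append, ih]
    simp

theorem length_le_length_iterate_wordMap {s : A → List A} (hs : ∀ a, s a ≠ []) (n : ℕ)
    (w : List A) : w.length ≤ ((wordMap s)^[n] w).length := by
  induction n generalizing w with
  | zero => simp
  | succ n ih => exact (length_le_length_wordMap hs w).trans (ih _)

theorem iterate_wordMap_infix_of_le {s : A → List A} {w : List A} (hw : w <:+: wordMap s w)
    {m n : ℕ} (hmn : m ≤ n) : (wordMap s)^[m] w <:+: (wordMap s)^[n] w := by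
  induction n, hmn using Nat.le_induction with
  | base => exact List.infix_rfl
  | succ n _ ih => exact ih.trans (iterate_wordMap_infix s n hw)

end WordMap

section OrbitLanguage

variable {A : Type*} {s : A → List A} {S : Set (List A)}

/-- The set of factors of the iterated images under `s` of the words of `S`. -/
def orbitLanguage (s : A → List A) (S : Set (List A)) : Set (List A) :=
  {t | ∃ n, ∃ w ∈ S, t <:+: (wordMap s)^[n] w}

theorem isFactorial_orbitLanguage (s : A → List A) (S : Set (List A)) :
    IsFactorial (orbitLanguage s S) := by
  rintro t ⟨n, w, hw, ht⟩ u hu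
  exact ⟨n, w, hw, hu.trans ht⟩

/-- The set of the languages of the two-sided sequences all of whose factors lie in `L`. -/
def languagesIn (L : Set (List A)) : Set (Set (List A)) :=
  {K | ∃ x, seqLanguage x ⊆ L ∧ K = seqLanguage x}

theorem finite_languagesIn_iUnion {β : Type*} [Finite β] {K : β → Set (List A)}
    (hK : ∀ b, IsFactorial (K b)) (hfin : ∀ b, (languagesIn (K b)).Finite) :
    (languagesIn (⋃ b, K b)).Finite := by
  refine (Set.finite_iUnion hfin).subset ?_
  rintro _ ⟨x, hx, rfl⟩
  obtain ⟨b, hb⟩ := exists_seqLanguage_subset hK hx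
  exact Set.mem_iUnion.2 ⟨b, x, hb, rfl⟩

end OrbitLanguage

section Desubstitution

variable {A B : Type*} {φ : B → List A} {x : ℤ → A} {y : ℤ → B} {c : ℤ → ℤ} {L : Set (List B)}

/-- The image of the letter `y i` under the morphism `φ` occupies the positions from `c i` to
`c (i + 1)` of `x`. -/
def DesubAt (φ : B → List A) (x : ℤ → A) (y : ℤ → B) (c : ℤ → ℤ) (i : ℤ) : Prop :=
  c (i + 1) = c i + (φ (y i)).length ∧ Occurs x (c i) (φ (y i))

/-- The sequence `x` is the image of `y` under the morphism `φ`, where the image of the letter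
`y i` starts at position `c i` of `x`. -/
def Desub (φ : B → List A) (x : ℤ → A) (y : ℤ → B) (c : ℤ → ℤ) : Prop :=
  ∀ i, DesubAt φ x y c i

theorem Desub.occurs (h : Desub φ x y c) {i : ℤ} {w : List B} (hw : Occurs y i w) :
    Occurs x (c i) (wordMap φ w) ∧ c (i + w.length) = c i + (wordMap φ w).length := by
  induction w generalizing i with
  | nil => simp
  | cons b w ih =>
    rw [occurs_cons] at hw
    obtain ⟨h₁, h₂⟩ := ih hw.2
    obtain ⟨h₃, h₄⟩ := h i
    rw [hw.1] at h₃ h₄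
    rw [h₃] at h₁ h₂
    simp only [wordMap_cons, List.length_cons, List.length_append, Nat.cast_add, Nat.cast_one]
    refine ⟨occurs_append.2 ⟨h₄, h₁⟩, ?_⟩
    rw [add_comm (w.length : ℤ) 1, ← add_assoc, h₂]
    ring

theorem Desub.add_le (hφ : ∀ b, φ b ≠ []) (h : Desub φ x y c) (i : ℤ) (n : ℕ) :
    c i + n ≤ c (i + n) := by
  have h₁ := (h.occurs (occurs_block y i n)).2
  have h₂ := length_le_length_wordMap hφ (block y i n)
  rw [length_block] at h₁ h₂
  omega

theorem Desub.strictMono (hφ : ∀ b, φ b ≠ []) (h : Desub φ x y c) : StrictMono c :=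
  strictMono_int_of_lt_succ fun i => by
    have := List.length_pos_iff.2 (hφ (y i))
    rw [(h i).1]
    omega

theorem Desub.infix_wordMap_block (hφ : ∀ b, φ b ≠ []) (h : Desub φ x y c) (i : ℤ) (n : ℕ) :
    ∃ N : ℕ, block x i n <:+: wordMap φ (block y (-N) (N + N)) := by
  let N : ℕ := (c 0 - i).toNat + (i + n - c 0).toNat
  obtain ⟨hocc, hend⟩ := h.occurs (occurs_block y (-N) (N + N))
  have hleft := h.add_le hφ (-N) N
  have hright := h.add_le hφ 0 N
  rw [length_block, show (-N : ℤ) + ((N + N : ℕ) : ℤ) = 0 + N by push_cast; ring] at hend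
  rw [neg_add_cancel] at hleft
  exact ⟨N, hocc.infix_of_le (occurs_block x i n) (by omega) (by rw [length_block]; omega)⟩

theorem Desub.seqLanguage_eq (hφ : ∀ b, φ b ≠ []) (h : Desub φ x y c) :
    seqLanguage x = {t | ∃ w ∈ seqLanguage y, t <:+: wordMap φ w} := by
  ext t
  constructor
  · rintro ⟨i, n, rfl⟩
    obtain ⟨N, hN⟩ := h.infix_wordMap_block hφ i n
    exact ⟨_, ⟨_, _, rfl⟩, hN⟩
  · rintro ⟨w, hw, ht⟩
    obtain ⟨i, hi⟩ := mem_seqLanguage.1 hw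
    exact isFactorial_seqLanguage x (h.occurs hi).1.mem_seqLanguage ht

theorem exists_prefix_wordMap {M : ℕ} (hM : ∀ b, (φ b).length ≤ M) {w : List B} {t : List A}
    (ht : t <+: wordMap φ w) :
    ∃ w' q, w' <+: w ∧ t = wordMap φ w' ++ q ∧ q.length ≤ M := by
  induction w generalizing t with
  | nil => exact ⟨[], [], List.nil_prefix, by simpa using ht, by simp⟩
  | cons b w ih =>
    rw [wordMap_cons] at ht
    rcases le_total t.length (φ b).length with h | h
    · exact ⟨[], t, List.nil_prefix, by simp, h.trans (hM b)⟩
    · obtain ⟨t', rfl⟩ := List.prefix_of_prefix_length_le (List.prefix_append _ _) ht h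
      rw [List.prefix_append_right_inj] at ht
      obtain ⟨w', q, hw', rfl, hq⟩ := ih ht
      exact ⟨b :: w', q, by simpa using hw', by simp, hq⟩

theorem exists_infix_wordMap {M : ℕ} (hM : ∀ b, (φ b).length ≤ M) {w : List B} {t : List A}
    (ht : t <:+: wordMap φ w) :
    ∃ p w' q, w' <:+: w ∧ t = p ++ (wordMap φ w' ++ q) ∧ p.length ≤ M ∧ q.length ≤ M := by
  induction w generalizing t with
  | nil => exact ⟨[], [], [], List.nil_infix, by simpa using ht, by simp, by simp⟩
  | cons b w ih =>
    rw [wordMap_cons, List.infix_append_iff] at ht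
    rcases ht with ht | ht | ⟨t₁, t₂, rfl, h₁, h₂⟩
    · exact ⟨t, [], [], List.nil_infix, by simp, ht.length_le.trans (hM b), by simp⟩
    · obtain ⟨p, w', q, hw', hpq⟩ := ih ht
      exact ⟨p, w', q, hw'.trans (List.suffix_cons _ _).isInfix, hpq⟩
    · obtain ⟨w', q, hw', rfl, hq⟩ := exists_prefix_wordMap hM h₂
      exact ⟨t₁, w', q, hw'.isInfix.trans (List.suffix_cons _ _).isInfix, rfl,
        h₁.length_le.trans (hM b), hq⟩

theorem exists_split_wordMap {w : List B} {m : ℕ} (hm : m < (wordMap φ w).length) :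
    ∃ l b r, w = l ++ b :: r ∧ (wordMap φ l).length ≤ m ∧
      m < (wordMap φ l).length + (φ b).length := by
  induction w generalizing m with
  | nil => simp at hm
  | cons b w ih =>
    by_cases h : m < (φ b).length
    · exact ⟨[], b, w, rfl, by simp, by simpa using h⟩
    · rw [wordMap_cons, List.length_append] at hm
      obtain ⟨l, b', r, rfl, h₁, h₂⟩ := ih (m := m - (φ b).length) (by omega)
      refine ⟨b :: l, b', r, rfl, ?_, ?_⟩ <;> rw [wordMap_cons, List.length_append] <;> omega

theorem exists_occurs_desubAt {w : List B} {a : ℤ} (hne : w ≠ [])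
    (h : Occurs x a (wordMap φ w)) (k : ℕ) :
    ∃ y c, Occurs y (-k) w ∧
      (∀ l r, w = l ++ r → c (l.length - k) = a + (wordMap φ l).length) ∧
      ∀ i : ℤ, -k ≤ i → i < w.length - k → DesubAt φ x y c i := by
  let y : ℤ → B := fun i => w.getD (i + k).toNat (w.head hne)
  let c : ℤ → ℤ := fun i => a + (wordMap φ (w.take (i + k).toNat)).length
  have hy : Occurs y (-k) w := List.ext_getElem (by simp) fun n h₁ h₂ => by
    simp [y, List.getElem?_eq_getElem h₂]
  have hc (l r : List B) (hw : w = l ++ r) : c (l.length - k) = a + (wordMap φ l).length := by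
    simp [c, hw]
  refine ⟨y, c, hy, hc, fun i hi hik => ?_⟩
  obtain ⟨l, b, r, rfl, hl⟩ : ∃ l b r, w = l ++ b :: r ∧ (l.length : ℤ) = i + k :=
    have hlt : (i + k).toNat < w.length := by omega
    ⟨w.take (i + k).toNat, w[(i + k).toNat], w.drop ((i + k).toNat + 1), by simp,
      by rw [List.length_take]; omega⟩
  rw [occurs_append, occurs_cons] at hy
  have hyi : y i = b := by rw [← hy.2.1]; congr 1; omega
  have hci : c i = a + (wordMap φ l).length := by rw [← hc l _ rfl]; congr 1; omega
  have hci' : c (i + 1) = a + (wordMap φ (l ++ [b])).length := by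
    rw [← hc (l ++ [b]) r (by simp)]
    congr 1
    rw [List.length_append, List.length_singleton]
    omega
  rw [wordMap_append, occurs_append, wordMap_cons, occurs_append] at h
  refine ⟨?_, ?_⟩
  · rw [hci', hci, hyi]
    simp [add_assoc]
  · rw [hci, hyi]
    exact h.2.1

theorem exists_window {M : ℕ} (hM : ∀ b, (φ b).length ≤ M) (hL : IsFactorial L)
    (hx : ∀ t ∈ seqLanguage x, ∃ w ∈ L, t <:+: wordMap φ w) (N : ℕ) :
    ∃ w ∈ L, ∃ a ≤ -(N : ℤ), Occurs x a (wordMap φ w) ∧ N ≤ a + (wordMap φ w).length := by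
  obtain ⟨w', hw', ht⟩ := hx (block x (-(N + M : ℕ)) ((N + M) + (N + M))) ⟨_, _, rfl⟩
  obtain ⟨p, w, q, hw, hpq, hp, hq⟩ := exists_infix_wordMap hM ht
  have hlen := congrArg List.length hpq
  simp only [length_block, List.length_append] at hlen
  have hocc := occurs_block x (-(N + M : ℕ)) ((N + M) + (N + M))
  rw [hpq, occurs_append, occurs_append] at hocc
  exact ⟨w, hL hw' hw, _, by omega, hocc.2.1, by omega⟩

theorem exists_local_desub {M : ℕ} (hM : ∀ b, (φ b).length ≤ M) (hL : IsFactorial L)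
    (hx : ∀ t ∈ seqLanguage x, ∃ w ∈ L, t <:+: wordMap φ w) (I : ℕ) :
    ∃ y c, c 0 ∈ Set.Icc (-(M : ℤ)) 0 ∧ 0 < c 1 ∧ block y (-I) (I + I) ∈ L ∧
      ∀ i : ℤ, i.natAbs ≤ I → DesubAt φ x y c i := by
  obtain ⟨w, hw, a, ha, hocc, hend⟩ := exists_window hM hL hx (M * I + M + 1)
  obtain ⟨l, b, r, rfl, hl, hb⟩ := exists_split_wordMap (φ := φ) (w := w) (m := (-a).toNat)
    (by omega)
  obtain ⟨y, c, hy, hc, hdes⟩ := exists_occurs_desubAt (by simp) hocc l.length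
  have hbM := hM b
  have hlI : I < l.length := by
    have := length_wordMap_le hM l
    exact Nat.lt_of_mul_lt_mul_left (a := M) (by omega)
  have hrI : I < r.length := by
    have := length_wordMap_le hM r
    simp only [wordMap_append, wordMap_cons, List.length_append] at hend
    exact Nat.lt_of_mul_lt_mul_left (a := M) (by omega)
  have hc0 : c 0 = a + (wordMap φ l).length := by simpa using hc l _ rfl
  have hc1 : c 1 = a + ((wordMap φ l).length + (φ b).length : ℕ) := by
    simpa using hc (l ++ [b]) r (by simp)
  have hlen : (l ++ b :: r).length = l.length + (r.length + 1) := by simp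
  refine ⟨y, c, ⟨by omega, by omega⟩, by omega, ?_, fun i hi => hdes i (by omega) (by omega)⟩
  exact hL hw (hy.infix_of_le (occurs_block _ _ _) (by omega) (by rw [length_block]; omega))

theorem exists_eventually_eq_of_eventually_mem {X ι : Type*} (U : Ultrafilter ι) {S : Set X}
    (hS : S.Finite) {f : ι → X} (hf : ∀ᶠ n in U, f n ∈ S) : ∃ v, ∀ᶠ n in U, f n = v := by
  have : ∀ᶠ n in U, ∃ v ∈ S, f n = v := by simpa using hf
  obtain ⟨v, -, hv⟩ := (Ultrafilter.eventually_exists_mem_iff hS).1 this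
  exact ⟨v, hv⟩

theorem exists_eventually_eq_of_desubAt [Finite B] {ι : Type*} (U : Ultrafilter ι)
    {y : ι → ℤ → B} {c : ι → ℤ → ℤ} {T : Set ℤ} (hT : T.Finite) (hc₀ : ∀ᶠ J in U, c J 0 ∈ T)
    (hdes : ∀ i, ∀ᶠ J in U, DesubAt φ x (y J) (c J) i) (i : ℤ) :
    ∃ k, ∀ᶠ J in U, c J i = k := by
  have hy (i : ℤ) : ∃ b, ∀ᶠ J in U, y J i = b :=
    exists_eventually_eq_of_eventually_mem U Set.finite_univ (by simp)
  induction i using Int.induction_on with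
  | zero => exact exists_eventually_eq_of_eventually_mem U hT hc₀
  | succ i ih =>
    obtain ⟨k, hk⟩ := ih
    obtain ⟨b, hb⟩ := hy i
    refine ⟨k + (φ b).length, ?_⟩
    filter_upwards [hk, hb, hdes i] with J hkJ hbJ hJ
    rw [hJ.1, hkJ, hbJ]
  | pred i ih =>
    obtain ⟨k, hk⟩ := ih
    obtain ⟨b, hb⟩ := hy (-i - 1)
    refine ⟨k - (φ b).length, ?_⟩
    filter_upwards [hk, hb, hdes (-i - 1)] with J hkJ hbJ hJ
    have := hJ.1
    rw [sub_add_cancel, hkJ, hbJ] at this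
    omega

/-- A limit, along a nonprincipal ultrafilter, of desubstitutions of larger and larger windows. -/
theorem exists_desub [Finite B] (hL : IsFactorial L)
    (hx : ∀ t ∈ seqLanguage x, ∃ w ∈ L, t <:+: wordMap φ w) :
    ∃ y c, Desub φ x y c ∧ seqLanguage y ⊆ L ∧ c 0 ≤ 0 ∧ 0 < c 1 := by
  obtain ⟨M, hM⟩ := (Set.finite_range fun b => (φ b).length).bddAbove
  choose y c hc0 hc1 hyL hdes using exists_local_desub (fun b => hM ⟨b, rfl⟩) hL hx
  let U : Ultrafilter ℕ := hyperfilter ℕ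
  have hU (I : ℕ) : ∀ᶠ J in (U : Filter ℕ), I ≤ J :=
    Nat.hyperfilter_le_atTop (eventually_ge_atTop I)
  have hdes' (i : ℤ) : ∀ᶠ J in (U : Filter ℕ), DesubAt φ x (y J) (c J) i :=
    (hU i.natAbs).mono fun J hJ => hdes J i hJ
  choose y' hy' using fun i : ℤ => exists_eventually_eq_of_eventually_mem U
    (Set.finite_univ (α := B)) (f := fun J => y J i) (by simp)
  choose c' hc' using exists_eventually_eq_of_desubAt U (Set.finite_Icc (-(M : ℤ)) 0)
    (Eventually.of_forall hc0) hdes'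
  refine ⟨y', c', fun i => ?_, ?_, ?_, ?_⟩
  · obtain ⟨J, hJ, h₁, h₂, h₃⟩ :=
      ((hdes' i).and <| (hy' i).and <| (hc' i).and (hc' (i + 1))).exists
    rwa [DesubAt, h₁, h₂, h₃] at hJ
  · rintro _ ⟨i, n, rfl⟩
    have hblock : ∀ᶠ J in (U : Filter ℕ), ∀ k : Fin n, y J (i + k) = y' (i + k) :=
      eventually_all.2 fun k => hy' _
    obtain ⟨J, hJ, hJn⟩ := (hblock.and (hU (i.natAbs + n))).exists
    have : block y' i n = block (y J) i n := congrArg List.ofFn (funext fun k => (hJ k).symm)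
    rw [this]
    exact hL (hyL J) (infix_block (by omega) (by omega))
  · obtain ⟨J, hJ⟩ := (hc' 0).exists
    exact hJ ▸ (hc0 J).2
  · obtain ⟨J, hJ⟩ := (hc' 1).exists
    exact hJ ▸ hc1 J

end Desubstitution

section Powers

variable {A : Type*} {x : ℤ → A} {v w z u t : List A}

/-- The `k`-th power of a word. -/
def wordPow (w : List A) (k : ℕ) : List A :=
  (List.replicate k w).flatten

@[simp] theorem wordPow_zero (w : List A) : wordPow w 0 = [] := rfl

@[simp] theorem wordPow_nil (k : ℕ) : wordPow ([] : List A) k = [] := by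
  simp [wordPow]

theorem wordPow_add (w : List A) (m n : ℕ) : wordPow w (m + n) = wordPow w m ++ wordPow w n := by
  rw [wordPow, List.replicate_add, List.flatten_append]
  rfl

theorem wordPow_one (w : List A) : wordPow w 1 = w := by
  simp [wordPow]

theorem wordPow_succ (w : List A) (k : ℕ) : wordPow w (k + 1) = w ++ wordPow w k := by
  rw [add_comm, wordPow_add, wordPow_one]

theorem wordPow_succ' (w : List A) (k : ℕ) : wordPow w (k + 1) = wordPow w k ++ w := by
  rw [wordPow_add, wordPow_one]

@[simp] theorem length_wordPow (w : List A) (k : ℕ) : (wordPow w k).length = k * w.length := by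
  simp [wordPow]

theorem wordMap_unit (v : List A) (w : List Unit) :
    wordMap (fun _ => v) w = wordPow v w.length := by
  induction w with
  | nil => rfl
  | cons a w ih => rw [wordMap_cons, ih, List.length_cons, wordPow_succ]

/-- The language of the periodic sequence with period `v`. -/
def powerLanguage (v : List A) : Set (List A) :=
  {t | ∃ k, t <:+: wordPow v k}

/-- The factors of the words `v^k z u^k`. -/
def pumpLanguage (v z u : List A) : Set (List A) :=
  {t | ∃ k, t <:+: wordPow v k ++ (z ++ wordPow u k)}

theorem isFactorial_pumpLanguage (v z u : List A) : IsFactorial (pumpLanguage v z u) :=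
  isFactorial_setOf_infix _

theorem pump_add (v z u : List A) (j k : ℕ) :
    wordPow v (j + k) ++ (z ++ wordPow u (j + k)) =
      wordPow v j ++ (wordPow v k ++ (z ++ wordPow u k)) ++ wordPow u j := by
  rw [wordPow_add v, add_comm j k, wordPow_add u]
  simp only [List.append_assoc]

theorem exists_extension_right (hw : w ∈ seqLanguage x) (n : ℕ) :
    ∃ r, r.length = n ∧ w ++ r ∈ seqLanguage x := by
  obtain ⟨i, m, rfl⟩ := hw
  exact ⟨block x (i + m) n, by simp, i, m + n, (block_add ..).symm⟩

theorem exists_extension_left (hw : w ∈ seqLanguage x) (n : ℕ) :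
    ∃ r, r.length = n ∧ r ++ w ∈ seqLanguage x := by
  obtain ⟨i, m, rfl⟩ := hw
  refine ⟨block x (i - n) n, by simp, i - n, n + m, ?_⟩
  rw [block_add, sub_add_cancel]

theorem infix_left_of_infix_append {r a q : List A} (h : w ++ r <:+: a ++ q)
    (hr : q.length ≤ r.length) : w <:+: a := by
  obtain ⟨p, s, h⟩ := h
  have h₁ : p ++ w <+: a ++ q := ⟨r ++ s, by rw [← h]; simp⟩
  have h₂ : p ++ w <+: a := by
    refine List.prefix_of_prefix_length_le h₁ (List.prefix_append _ _) ?_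
    have := congrArg List.length h
    simp only [List.length_append] at this ⊢
    omega
  exact (List.suffix_append p w).isInfix.trans h₂.isInfix

theorem infix_right_of_infix_append {r a q : List A} (h : r ++ w <:+: q ++ a)
    (hr : q.length ≤ r.length) : w <:+: a := by
  rw [← List.reverse_infix] at h ⊢
  rw [List.reverse_append, List.reverse_append] at h
  exact infix_left_of_infix_append h (by simpa using hr)

theorem infix_or_infix_of_not_infix {a b : List A} (h : w <:+: a ++ t ++ b)
    (ht : ¬ t <:+: w) : w <:+: a ++ t ∨ w <:+: t ++ b := by
  rw [List.infix_append_iff] at h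
  rcases h with h | h | ⟨w₁, w₂, rfl, h₁, h₂⟩
  · exact Or.inl h
  · exact Or.inr (h.trans (List.suffix_append _ _).isInfix)
  · right
    rcases List.suffix_or_suffix_of_suffix h₁ (List.suffix_append a t) with h | h
    · obtain ⟨p, rfl⟩ := h
      obtain ⟨q, rfl⟩ := h₂
      exact ⟨p, q, by simp⟩
    · exact absurd (h.isInfix.trans (List.prefix_append _ _).isInfix) ht

/-- Desubstitution by the morphism that maps a single letter to `v`. -/
theorem seqLanguage_eq_powerLanguage (h : seqLanguage x ⊆ powerLanguage v) :
    seqLanguage x = powerLanguage v := by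
  refine h.antisymm ?_
  rintro t ⟨k, hk⟩
  obtain ⟨y, c, hyc, -⟩ := exists_desub (φ := fun _ : Unit => v) (L := Set.univ) (x := x)
    (fun _ _ _ _ => trivial) fun t ht => by
      obtain ⟨j, hj⟩ := h ht
      exact ⟨List.replicate j (), trivial, by simpa [wordMap_unit] using hj⟩
  have hocc := (hyc.occurs (occurs_block y 0 k)).1
  rw [wordMap_unit, length_block] at hocc
  exact isFactorial_seqLanguage x hocc.mem_seqLanguage hk

theorem seqLanguage_eq_powerLanguage_left
    (h : seqLanguage x ⊆ {t | ∃ k, t <:+: wordPow v k ++ w}) :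
    seqLanguage x = powerLanguage v := by
  refine seqLanguage_eq_powerLanguage fun t ht => ?_
  obtain ⟨r, hr, htr⟩ := exists_extension_right ht w.length
  obtain ⟨k, hk⟩ := h htr
  exact ⟨k, infix_left_of_infix_append hk hr.ge⟩

theorem seqLanguage_eq_powerLanguage_right
    (h : seqLanguage x ⊆ {t | ∃ k, t <:+: w ++ wordPow u k}) :
    seqLanguage x = powerLanguage u := by
  refine seqLanguage_eq_powerLanguage fun t ht => ?_
  obtain ⟨r, hr, htr⟩ := exists_extension_left ht w.length
  obtain ⟨k, hk⟩ := h htr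
  exact ⟨k, infix_right_of_infix_append hk hr.ge⟩

theorem mem_pumpLanguage_split {k : ℕ} (ht : t ∈ pumpLanguage v z u)
    (hk : ¬ wordPow v k ++ (z ++ wordPow u k) <:+: t) :
    (∃ j, t <:+: wordPow v j ++ (z ++ wordPow u k)) ∨
      ∃ j, t <:+: (wordPow v k ++ z) ++ wordPow u j := by
  obtain ⟨j, hj⟩ := ht
  have hj' : t <:+: wordPow v j ++ (wordPow v k ++ (z ++ wordPow u k)) ++ wordPow u j := by
    rw [← pump_add, add_comm, pump_add]
    exact hj.trans ⟨wordPow v k, wordPow u k, by simp⟩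
  rcases infix_or_infix_of_not_infix hj' hk with h | h
  · exact Or.inl ⟨j + k, by simpa only [wordPow_add, List.append_assoc] using h⟩
  · exact Or.inr ⟨k + j, by simpa only [wordPow_add, List.append_assoc] using h⟩

theorem seqLanguage_eq_of_subset_pumpLanguage (h : seqLanguage x ⊆ pumpLanguage v z u) :
    seqLanguage x = pumpLanguage v z u ∨ seqLanguage x = powerLanguage v ∨
      seqLanguage x = powerLanguage u := by
  by_cases hall : ∀ k, wordPow v k ++ (z ++ wordPow u k) ∈ seqLanguage x
  · refine Or.inl (h.antisymm ?_)
    rintro t ⟨k, hk⟩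
    exact isFactorial_seqLanguage x (hall k) hk
  push Not at hall
  obtain ⟨k, hk⟩ := hall
  have hcover : seqLanguage x ⊆ {t | ∃ j, t <:+: wordPow v j ++ (z ++ wordPow u k)} ∪
      {t | ∃ j, t <:+: (wordPow v k ++ z) ++ wordPow u j} := fun t ht =>
    mem_pumpLanguage_split (h ht) fun hkt => hk (isFactorial_seqLanguage x ht hkt)
  rcases seqLanguage_subset_or (isFactorial_setOf_infix _) (isFactorial_setOf_infix _)
    hcover with hx | hx
  · exact Or.inr (Or.inl (seqLanguage_eq_powerLanguage_left hx))
  · exact Or.inr (Or.inr (seqLanguage_eq_powerLanguage_right hx))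

theorem finite_languagesIn_pumpLanguage (v z u : List A) :
    (languagesIn (pumpLanguage v z u)).Finite := by
  refine (Set.toFinite {pumpLanguage v z u, powerLanguage v, powerLanguage u}).subset ?_
  rintro _ ⟨x, hx, rfl⟩
  exact seqLanguage_eq_of_subset_pumpLanguage hx

end Powers

section FirstMoving

variable {A : Type*} {P : A → Prop} {w t t' : List A} {a b : A}

theorem exists_prefix_first (h : ∃ a ∈ w, ¬ P a) :
    ∃ t a, t ++ [a] <+: w ∧ (∀ c ∈ t, P c) ∧ ¬ P a := by
  induction w with
  | nil => simp at h
  | cons b w ih =>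
    by_cases hb : P b
    · obtain ⟨t, a, htw, ht, ha⟩ := ih (by simpa [hb] using h)
      exact ⟨b :: t, a, by simpa using htw, by simpa using ⟨hb, ht⟩, ha⟩
    · exact ⟨[], b, by simp, by simp, hb⟩

theorem exists_suffix_last (h : ∃ a ∈ w, ¬ P a) :
    ∃ t a, a :: t <:+ w ∧ (∀ c ∈ t, P c) ∧ ¬ P a := by
  obtain ⟨t, a, htw, ht, ha⟩ := exists_prefix_first (w := w.reverse) (by simpa using h)
  exact ⟨t.reverse, a, by simpa [← List.reverse_prefix] using htw, by simpa using ht, ha⟩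

theorem prefix_first_unique (hw : t ++ [a] <+: w) (hw' : t' ++ [b] <+: w)
    (ht : ∀ c ∈ t, P c) (ht' : ∀ c ∈ t', P c) (ha : ¬ P a) (hb : ¬ P b) : t = t' ∧ a = b := by
  suffices h : t ++ [a] = t' ++ [b] by simpa using List.append_inj' h rfl
  rcases List.prefix_or_prefix_of_prefix hw hw' with h | h <;>
    rcases List.prefix_concat_iff.1 h with h | h
  · exact h
  · exact absurd (ht' a (h.subset (by simp))) ha
  · exact h.symm
  · exact absurd (ht b (h.subset (by simp))) hb

theorem suffix_last_unique (hw : a :: t <:+ w) (hw' : b :: t' <:+ w)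
    (ht : ∀ c ∈ t, P c) (ht' : ∀ c ∈ t', P c) (ha : ¬ P a) (hb : ¬ P b) : t = t' ∧ a = b := by
  rw [← List.reverse_prefix, List.reverse_cons] at hw hw'
  obtain ⟨h, rfl⟩ :=
    prefix_first_unique hw hw' (by simpa using ht) (by simpa using ht') ha hb
  exact ⟨List.reverse_injective h, rfl⟩

end FirstMoving

section Split

variable {A : Type*} {s : A → List A} {w t : List A} {a g h : A}

/-- The morphism `s` fixes the letter `a`. A letter that is not fixed is called *moving*. -/
def IsFixed (s : A → List A) (a : A) : Prop :=
  s a = [a]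

/-- All letters of the word `t` are fixed by `s`. -/
def IsFixedWord (s : A → List A) (t : List A) : Prop :=
  ∀ c ∈ t, IsFixed s c

theorem IsFixedWord.wordMap_eq (ht : IsFixedWord s t) : wordMap s t = t := by
  rw [wordMap_congr (t := List.singleton) ht]
  exact List.flatMap_singleton' t

theorem isFixedWord_append {t' : List A} :
    IsFixedWord s (t ++ t') ↔ IsFixedWord s t ∧ IsFixedWord s t' :=
  List.forall_mem_append

/-- The mirror image of a morphism. -/
def revMap (s : A → List A) (a : A) : List A :=
  (s a).reverse

@[simp] theorem revMap_revMap (s : A → List A) : revMap (revMap s) = s :=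
  funext fun a => List.reverse_reverse (s a)

@[simp] theorem isFixed_revMap : IsFixed (revMap s) a ↔ IsFixed s a := by
  rw [IsFixed, IsFixed, revMap, List.reverse_eq_iff, List.reverse_singleton]

/-- The image of each moving letter `g` starts with the word `u g` over fixed letters and the
moving letter `f g`. -/
structure IsHead (s : A → List A) (f : A → A) (u : A → List A) : Prop where
  fixed : ∀ g, ¬ IsFixed s g → IsFixedWord s (u g)
  moving : ∀ g, ¬ IsFixed s g → ¬ IsFixed s (f g)
  isPrefix : ∀ g, ¬ IsFixed s g → u g ++ [f g] <+: s g

variable {e : A} {f l : A → A} {u v : A → List A}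

theorem IsHead.ne_nil (H : IsHead s f u) (a : A) : s a ≠ [] := by
  intro ha
  have := H.isPrefix a fun hfix => by simp [IsFixed, ha] at hfix
  simp [ha] at this

theorem IsHead.exists_prefix (H : IsHead s f u) (ht : IsFixedWord s t) (hh : ¬ IsFixed s h)
    (hp : t ++ [h] <+: wordMap s w) :
    ∃ t' h', t' ++ [h'] <+: w ∧ IsFixedWord s t' ∧ ¬ IsFixed s h' ∧ t = t' ++ u h' ∧
      h = f h' := by
  have hmoving : ∃ a ∈ w, ¬ IsFixed s a := by
    by_contra! hw
    rw [IsFixedWord.wordMap_eq hw] at hp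
    exact hh (hw h (hp.subset (by simp)))
  obtain ⟨t', h', htw, ht', hh'⟩ := exists_prefix_first hmoving
  have hfirst : (t' ++ u h') ++ [f h'] <+: wordMap s w := by
    obtain ⟨r, rfl⟩ := htw
    obtain ⟨q, hq⟩ := H.isPrefix h' hh'
    exact ⟨q ++ wordMap s r, by simp [IsFixedWord.wordMap_eq ht', ← hq]⟩
  obtain ⟨rfl, rfl⟩ := prefix_first_unique hp hfirst ht
    (isFixedWord_append.2 ⟨ht', H.fixed h' hh'⟩) hh (H.moving h' hh')
  exact ⟨t', h', htw, ht', hh', rfl, rfl⟩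

/-- The normal form of a morphism in which the gaps between consecutive moving letters grow in a
regular way: every moving letter `g` has an image of the form `u g (f g) ⋯ (l g) v g` with `u g`
and `v g` over fixed letters and `f g` and `l g` moving, where `f` and `l` are idempotent, and a
letter that recurs under iteration recurs at once. The letter `e` is a seed: its image begins and
ends with `e`. The tail is stated as the head of the mirror image. -/
structure IsSplit (s : A → List A) (e : A) (f l : A → A) (u v : A → List A) : Prop where
  head : IsHead s f u
  tail : IsHead (revMap s) l fun g => (v g).reverse
  head_idem : ∀ g, f (f g) = f g
  tail_idem : ∀ g, l (l g) = l g
  seed : ∃ m, s e = e :: (m ++ [e])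
  recurrent : ∀ g n, g ∈ (wordMap s)^[n + 1] [g] → g ∈ s g

/-- The word `t` over fixed letters is delimited by the moving letters `g` and `h`. -/
structure IsGap (s : A → List A) (g : A) (t : List A) (h : A) : Prop where
  left : ¬ IsFixed s g
  fixed : IsFixedWord s t
  right : ¬ IsFixed s h

theorem exists_suffix_of_suffix_wordMap {B : Type*} {s : B → List A} {w : List B} {r : List A}
    (hr : g :: r <:+ wordMap s w) :
    ∃ a w' r', a :: w' <:+ w ∧ g :: r' <:+ s a ∧ r = r' ++ wordMap s w' := by
  induction w with
  | nil => simp at hr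
  | cons a w ih =>
    obtain ⟨p, hp⟩ := hr
    rw [wordMap_cons, List.append_eq_append_iff] at hp
    rcases hp with ⟨_ | ⟨b, r'⟩, hsa, hgr⟩ | ⟨q, -, hq⟩
    · obtain ⟨b, w', r', hw', hr'⟩ := ih (hgr ▸ List.suffix_rfl)
      exact ⟨b, w', r', hw'.trans (List.suffix_cons a w), hr'⟩
    · obtain ⟨rfl, rfl⟩ := List.cons.inj hgr
      exact ⟨a, w, r', List.suffix_rfl, ⟨p, hsa.symm⟩, rfl⟩
    · obtain ⟨b, w', r', hw', hr'⟩ := ih ⟨q, hq.symm⟩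
      exact ⟨b, w', r', hw'.trans (List.suffix_cons a w), hr'⟩

namespace IsSplit

theorem tail_fixed (H : IsSplit s e f l u v) (hg : ¬ IsFixed s g) : IsFixedWord s (v g) := by
  simpa [IsFixedWord] using H.tail.fixed g (by simpa using hg)

theorem tail_moving (H : IsSplit s e f l u v) (hg : ¬ IsFixed s g) : ¬ IsFixed s (l g) := by
  simpa using H.tail.moving g (by simpa using hg)

theorem isSuffix (H : IsSplit s e f l u v) (hg : ¬ IsFixed s g) : l g :: v g <:+ s g := by
  simpa [revMap, ← List.reverse_prefix] using H.tail.isPrefix g (by simpa using hg)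

theorem not_isFixed_seed (H : IsSplit s e f l u v) : ¬ IsFixed s e := by
  obtain ⟨m, hm⟩ := H.seed
  simp [IsFixed, hm]

theorem exists_gap_of_gap (H : IsSplit s e f l u v) (ht : IsGap s g t h)
    (hi : g :: (t ++ [h]) <:+: wordMap s w) :
    (∃ a, t <:+: s a) ∨ ∃ g' t' h', g' :: (t' ++ [h']) <:+: w ∧ IsGap s g' t' h' ∧ g = l g' ∧
      h = f h' ∧ t = v g' ++ (t' ++ u h') := by
  obtain ⟨_ | ⟨b, r⟩, hpre, hsuf⟩ := List.infix_iff_prefix_suffix.1 hi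
  · simp at hpre
  obtain ⟨rfl, hr⟩ := List.cons_prefix_cons.1 hpre
  obtain ⟨a, w', r', haw, hra, rfl⟩ := exists_suffix_of_suffix_wordMap hsuf
  have hinner (hr' : t <+: r') : ∃ a, t <:+: s a :=
    ⟨a, hr'.isInfix.trans ((List.suffix_cons g r').trans hra).isInfix⟩
  rcases List.prefix_or_prefix_of_prefix hr (List.prefix_append r' _) with hr' | hr'
  · exact Or.inl (hinner ((List.prefix_append _ _).trans hr'))
  rcases List.prefix_concat_iff.1 hr' with rfl | ⟨t₁, rfl⟩
  · exact Or.inl (hinner (List.prefix_append _ _))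
  right
  rw [List.append_assoc, List.prefix_append_right_inj] at hr
  obtain ⟨hr'_fixed, ht₁⟩ := isFixedWord_append.1 ht.fixed
  have ha : ¬ IsFixed s a := fun ha => by
    have hga : g ∈ s a := hra.subset List.mem_cons_self
    rw [ha, List.mem_singleton] at hga
    exact ht.left (hga ▸ ha)
  obtain ⟨rfl, rfl⟩ := suffix_last_unique hra (H.isSuffix ha) hr'_fixed (H.tail_fixed ha) ht.left
    (H.tail_moving ha)
  obtain ⟨t', h', hw', ht', hh', rfl, rfl⟩ := H.head.exists_prefix ht₁ ht.right hr
  exact ⟨a, t', h', (by simpa using hw' : a :: (t' ++ [h']) <+: a :: w').isInfix.trans haw.isInfix,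
    ⟨ha, ht', hh'⟩, rfl, rfl, rfl⟩

end IsSplit

/-- The words `z` such that the gaps in the words `s^n e` have the form `v^k z u^k`. -/
def gapCenters (s : A → List A) (u v : A → List A) : Set (List A) :=
  {z | ∃ a, z <:+: s a} ∪ {z | ∃ g h a t, t <:+: s a ∧ v g ++ (t ++ u h) = z}

theorem finite_gapCenters [Finite A] (s : A → List A) (u v : A → List A) :
    (gapCenters s u v).Finite := by
  have hfin (a : A) : {z | z <:+: s a}.Finite :=
    (List.finite_toSet (s a).sublists).subset fun _ hz => List.mem_sublists.2 hz.sublist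
  refine Set.Finite.union ?_ ?_
  · rw [Set.ofPred_exists]
    exact Set.finite_iUnion hfin
  · simp only [Set.ofPred_exists]
    exact Set.finite_iUnion fun g => Set.finite_iUnion fun h => Set.finite_iUnion fun a => by
      simpa only [Set.image, Set.ofPred_exists, Set.mem_ofPred_eq] using
        (hfin a).image fun t => v g ++ (t ++ u h)

namespace IsSplit

theorem exists_gap_eq_of_infix (H : IsSplit s e f l u v) {n : ℕ} (ht : IsGap s g t h)
    (hi : g :: (t ++ [h]) <:+: (wordMap s)^[n] [e]) :
    (∃ a, t <:+: s a) ∨ (l g = g ∧ f h = h ∧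
      ∃ z ∈ gapCenters s u v, ∃ k, t = wordPow (v g) k ++ (z ++ wordPow (u h) k)) := by
  induction n generalizing g t h with
  | zero => simpa using hi.length_le
  | succ n ih =>
    rw [Function.iterate_succ_apply'] at hi
    rcases H.exists_gap_of_gap ht hi with ha | ⟨g', t', h', hi', ht', rfl, rfl, rfl⟩
    · exact Or.inl ha
    refine Or.inr ⟨H.tail_idem g', H.head_idem h', ?_⟩
    rcases ih ht' hi' with ⟨a, ha⟩ | ⟨hg, hh, z, hz, k, rfl⟩
    · exact ⟨_, Or.inr ⟨g', h', a, t', ha, rfl⟩, 0, by simp⟩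
    · refine ⟨z, hz, k + 1, ?_⟩
      rw [hg, hh, wordPow_succ, wordPow_succ']
      simp

theorem exists_gap_eq (H : IsSplit s e f l u v) (ht : IsGap s g t h)
    (hi : g :: (t ++ [h]) ∈ orbitLanguage s {[e]}) :
    ∃ z ∈ gapCenters s u v, ∃ k, t = wordPow (v g) k ++ (z ++ wordPow (u h) k) := by
  obtain ⟨n, w, rfl, hn⟩ := hi
  rcases H.exists_gap_eq_of_infix ht hn with ha | ⟨-, -, hz⟩
  · exact ⟨t, Or.inl ha, 0, by simp⟩
  · exact hz

theorem seed_mem_iterate (H : IsSplit s e f l u v) (n : ℕ) :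
    (∃ p, (wordMap s)^[n] [e] = e :: p) ∧ ∃ q, (wordMap s)^[n] [e] = q ++ [e] := by
  obtain ⟨m, hm⟩ := H.seed
  induction n with
  | zero => exact ⟨⟨[], rfl⟩, [], rfl⟩
  | succ n ih =>
    obtain ⟨⟨p, hp⟩, q, hq⟩ := ih
    rw [Function.iterate_succ_apply']
    refine ⟨⟨m ++ [e] ++ wordMap s p, ?_⟩, wordMap s q ++ e :: m, ?_⟩
    · rw [hp, wordMap_cons, hm]
      simp
    · rw [hq, wordMap_append, wordMap_cons, hm]
      simp

/-- `s (s e)` begins and ends with `e` and contains a further `e` in between. -/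
theorem exists_bracket (H : IsSplit s e f l u v) (ht : t ∈ orbitLanguage s {[e]}) :
    ∃ p q, e :: (p ++ (t ++ (q ++ [e]))) ∈ orbitLanguage s {[e]} := by
  obtain ⟨n, w, rfl, a, b, hn⟩ := ht
  obtain ⟨m, hm⟩ := H.seed
  obtain ⟨⟨p, hp⟩, q, hq⟩ := H.seed_mem_iterate n
  set w := (wordMap s)^[n] [e]
  have hiter : (wordMap s)^[n + 2] [e] =
      w ++ ((wordMap s)^[n] m ++ (w ++ ((wordMap s)^[n] (wordMap s m ++ e :: m) ++ w))) := by
    have hsq : wordMap s (wordMap s [e]) =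
        [e] ++ (m ++ ([e] ++ ((wordMap s m ++ e :: m) ++ [e]))) := by simp [hm]
    rw [Function.iterate_add_apply, Function.iterate_succ_apply, Function.iterate_one, hsq]
    iterate 4 rw [iterate_wordMap_append]
  refine ⟨p ++ (wordMap s)^[n] m ++ a, b ++ (wordMap s)^[n] (wordMap s m ++ e :: m) ++ q,
    n + 2, [e], rfl, [], [], ?_⟩
  rw [hiter, List.nil_append, List.append_nil]
  calc
    _ = (e :: p) ++ ((wordMap s)^[n] m ++ ((a ++ t ++ b) ++
        ((wordMap s)^[n] (wordMap s m ++ e :: m) ++ (q ++ [e])))) := by simp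
    _ = _ := by rw [← hp, hn, ← hq]

theorem exists_gap_right (H : IsSplit s e f l u v) (hg : ¬ IsFixed s g) (ht : IsFixedWord s t)
    (hgt : g :: t ∈ orbitLanguage s {[e]}) :
    ∃ q h, IsGap s g (t ++ q) h ∧ g :: ((t ++ q) ++ [h]) ∈ orbitLanguage s {[e]} := by
  obtain ⟨p, q, hpq⟩ := H.exists_bracket hgt
  obtain ⟨q', h, ⟨r, hr⟩, hq', hh⟩ := exists_prefix_first (w := q ++ [e])
    ⟨e, by simp, H.not_isFixed_seed⟩
  refine ⟨q', h, ⟨hg, isFixedWord_append.2 ⟨ht, hq'⟩, hh⟩, ?_⟩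
  rw [← hr] at hpq
  exact isFactorial_orbitLanguage s _ hpq ⟨e :: p, r, by simp⟩

theorem mem_pumpLanguage_of_isFixedWord (H : IsSplit s e f l u v) (ht : IsFixedWord s t)
    (hte : t ∈ orbitLanguage s {[e]}) :
    ∃ g h, ∃ z ∈ gapCenters s u v, t ∈ pumpLanguage (v g) z (u h) := by
  obtain ⟨p, q, hpq⟩ := H.exists_bracket hte
  obtain ⟨p', g, ⟨r, hr⟩, hp', hg⟩ := exists_suffix_last (w := e :: p)
    ⟨e, by simp, H.not_isFixed_seed⟩
  have hgt : g :: (p' ++ t) ∈ orbitLanguage s {[e]} := by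
    rw [← List.cons_append, ← hr] at hpq
    exact isFactorial_orbitLanguage s _ hpq ⟨r, q ++ [e], by simp⟩
  obtain ⟨q', h, hgap, hmem⟩ := H.exists_gap_right hg (isFixedWord_append.2 ⟨hp', ht⟩) hgt
  obtain ⟨z, hz, k, hk⟩ := H.exists_gap_eq hgap hmem
  exact ⟨g, h, z, hz, k, hk ▸ ⟨p', q', rfl⟩⟩

theorem finite_languages_of_isFixed [Finite A] (H : IsSplit s e f l u v) :
    {K | ∃ x, seqLanguage x ⊆ orbitLanguage s {[e]} ∧ (∀ i, IsFixed s (x i)) ∧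
      K = seqLanguage x}.Finite := by
  have := (finite_gapCenters s u v).to_subtype
  refine (finite_languagesIn_iUnion
    (K := fun p : A × A × gapCenters s u v => pumpLanguage (v p.1) p.2.2 (u p.2.1))
    (fun _ => isFactorial_pumpLanguage _ _ _)
    (fun _ => finite_languagesIn_pumpLanguage _ _ _)).subset ?_
  rintro _ ⟨x, hx, hfix, rfl⟩
  refine ⟨x, fun t ht => ?_, rfl⟩
  have htfix : IsFixedWord s t := by
    obtain ⟨i, n, rfl⟩ := ht
    intro c hc
    obtain ⟨k, rfl⟩ := (List.mem_ofFn' _ _).1 hc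
    exact hfix _
  obtain ⟨g, h, z, hz, htz⟩ := H.mem_pumpLanguage_of_isFixedWord htfix (hx ht)
  exact Set.mem_iUnion.2 ⟨(g, h, ⟨z, hz⟩), htz⟩

end IsSplit

end Split

section Chains

variable {A : Type*}

/-- A sequence of successive desubstitutions under `s`, aligned so that the letter `xs n 0` lies in
the image of the letter `xs (n + 1) 0`. -/
structure IsChain (s : A → List A) (xs : ℕ → ℤ → A) (c : ℕ → ℤ → ℤ) : Prop where
  desub : ∀ n, Desub s (xs n) (xs (n + 1)) (c n)
  zero_nonpos : ∀ n, c n 0 ≤ 0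
  one_pos : ∀ n, 0 < c n 1

/-- The cutting points of the `n`-fold desubstitution: the `n`-fold image of the letter `xs n i`
starts at position `cutComp c n i` of `xs 0`. -/
def cutComp (c : ℕ → ℤ → ℤ) : ℕ → ℤ → ℤ
  | 0 => id
  | n + 1 => cutComp c n ∘ c n

variable {s : A → List A} {xs : ℕ → ℤ → A} {c : ℕ → ℤ → ℤ} {S : Set (List A)} {w : List A}
  {i : ℤ} {n : ℕ} {g : A}

theorem exists_isChain [Finite A] {L : Set (List A)} {x : ℤ → A} (hL : IsFactorial L)
    (hsL : ∀ t ∈ L, ∃ w ∈ L, t <:+: wordMap s w) (hx : seqLanguage x ⊆ L) :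
    ∃ xs c, IsChain s xs c ∧ (∀ n, seqLanguage (xs n) ⊆ L) ∧ xs 0 = x := by
  have hstep (y : {y : ℤ → A // seqLanguage y ⊆ L}) :
      ∃ (z : {y : ℤ → A // seqLanguage y ⊆ L}) (c : ℤ → ℤ),
        Desub s y z c ∧ c 0 ≤ 0 ∧ 0 < c 1 := by
    obtain ⟨z, c, hdes, hz, hc⟩ := exists_desub hL fun t ht => hsL t (y.2 ht)
    exact ⟨⟨z, hz⟩, c, hdes, hc⟩
  choose Z C hZ hC₀ hC₁ using hstep
  let xs (n : ℕ) := Z^[n] ⟨x, hx⟩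
  refine ⟨fun n => xs n, fun n => C (xs n), ⟨fun n => ?_, fun n => hC₀ _, fun n => hC₁ _⟩,
    fun n => (xs n).2, rfl⟩
  simp only [xs, Function.iterate_succ_apply']
  exact hZ _

theorem length_lt_length_iterate_wordMap (hs : ∀ a, s a ≠ []) (hg : g ∈ s g) (hne : s g ≠ [g])
    (n : ℕ) : n < ((wordMap s)^[n] [g]).length := by
  obtain ⟨p, q, hpq⟩ := List.append_of_mem hg
  have hpos : 0 < p.length + q.length := by
    rw [← List.length_append, List.length_pos_iff]
    rintro h
    simp_all
  induction n with
  | zero => simp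
  | succ n ih =>
    have hp := length_le_length_iterate_wordMap hs n p
    have hq := length_le_length_iterate_wordMap hs n q
    rw [Function.iterate_succ_apply, wordMap_cons, wordMap_nil, List.append_nil, hpq,
      List.append_cons, iterate_wordMap_append, iterate_wordMap_append]
    simp only [List.length_append]
    omega

namespace IsChain

theorem occurs_iterate (hc : IsChain s xs c) (n : ℕ) (hw : Occurs (xs n) i w) :
    Occurs (xs 0) (cutComp c n i) ((wordMap s)^[n] w) ∧
      cutComp c n (i + w.length) = cutComp c n i + ((wordMap s)^[n] w).length := by
  induction n generalizing i w with
  | zero => exact ⟨hw, rfl⟩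
  | succ n ih =>
    obtain ⟨hocc, hlen⟩ := (hc.desub n).occurs hw
    obtain ⟨hocc', hlen'⟩ := ih hocc
    refine ⟨hocc', ?_⟩
    simp only [cutComp, Function.comp_apply, hlen, hlen', Function.iterate_succ_apply]

theorem cutComp_one (hc : IsChain s xs c) (n : ℕ) :
    cutComp c n 1 = cutComp c n 0 + ((wordMap s)^[n] [xs n 0]).length := by
  simpa using (hc.occurs_iterate n (i := 0) (w := [xs n 0]) (by simp)).2

theorem strictMono_cutComp (hc : IsChain s xs c) (hs : ∀ a, s a ≠ []) (n : ℕ) :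
    StrictMono (cutComp c n) := by
  induction n with
  | zero => exact strictMono_id
  | succ n ih => exact ih.comp ((hc.desub n).strictMono hs)

theorem monotone_cutComp_one (hc : IsChain s xs c) (hs : ∀ a, s a ≠ []) :
    Monotone fun n => cutComp c n 1 :=
  monotone_nat_of_le_succ fun n =>
    (hc.strictMono_cutComp hs n).monotone (show (1 : ℤ) ≤ c n 1 from hc.one_pos n)

theorem antitone_cutComp_zero (hc : IsChain s xs c) (hs : ∀ a, s a ≠ []) :
    Antitone fun n => cutComp c n 0 :=
  antitone_nat_of_succ_le fun n => (hc.strictMono_cutComp hs n).monotone (hc.zero_nonpos n)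

theorem mem_letter (hc : IsChain s xs c) (n : ℕ) : xs n 0 ∈ s (xs (n + 1) 0) := by
  obtain ⟨hlen, hocc⟩ := hc.desub n 0
  exact hocc.mem_of_lt (hc.zero_nonpos n) (hlen ▸ hc.one_pos n)

theorem mem_iterate (hc : IsChain s xs c) (n k : ℕ) :
    xs n 0 ∈ (wordMap s)^[k] [xs (n + k) 0] := by
  induction k with
  | zero => simp
  | succ k ih =>
    have h : [xs (n + k) 0] <:+: wordMap s [xs (n + (k + 1)) 0] := by
      simpa [List.singleton_infix_iff, ← add_assoc] using hc.mem_letter (n + k)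
    exact (iterate_wordMap_infix s k h).subset ih

theorem not_isFixed (hc : IsChain s xs c) (h0 : ¬ IsFixed s (xs 0 0)) (n : ℕ) :
    ¬ IsFixed s (xs n 0) := by
  induction n with
  | zero => exact h0
  | succ n ih =>
    intro h
    have hmem := hc.mem_letter n
    rw [h, List.mem_singleton] at hmem
    exact ih (hmem ▸ h)

theorem seqLanguage_eq_orbitLanguage (hc : IsChain s xs c)
    (hcover : ∀ B : ℤ, ∃ n i, ∃ w ∈ S, Occurs (xs n) i w ∧ cutComp c n i ≤ -B ∧
      B ≤ cutComp c n (i + w.length))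
    (hS : ∀ w ∈ S, w <:+: wordMap s w)
    (hfreq : ∀ w ∈ S, ∃ᶠ n in atTop, w ∈ seqLanguage (xs n)) :
    seqLanguage (xs 0) = orbitLanguage s S := by
  refine Set.Subset.antisymm ?_ ?_
  · rintro _ ⟨j, m, rfl⟩
    obtain ⟨n, i, w, hw, hocc, hleft, hright⟩ := hcover (j.natAbs + m)
    obtain ⟨hocc', hlen⟩ := hc.occurs_iterate n hocc
    exact ⟨n, w, hw, hocc'.infix_of_le (occurs_block _ _ _) (by omega)
      (by rw [length_block]; omega)⟩
  · rintro t ⟨n, w, hw, ht⟩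
    obtain ⟨m, hnm, hm⟩ := frequently_atTop.1 (hfreq w hw) n
    obtain ⟨i, hi⟩ := mem_seqLanguage.1 hm
    exact isFactorial_seqLanguage _ (hc.occurs_iterate m hi).1.mem_seqLanguage
      (ht.trans (iterate_wordMap_infix_of_le (hS w hw) hnm))

theorem exists_seqLanguage_eq_of_exhausting [Finite A] (hc : IsChain s xs c)
    (hs : ∀ a, s a ≠ []) (hrec : ∀ g n, g ∈ (wordMap s)^[n + 1] [g] → g ∈ s g)
    (h₀ : ∀ B, ∃ n, cutComp c n 0 < B) (h₁ : ∀ B, ∃ n, B < cutComp c n 1) :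
    ∃ g, seqLanguage (xs 0) = orbitLanguage s {[g]} := by
  obtain ⟨g, hg⟩ := exists_frequently_of_finite (l := atTop) (p := fun g n => xs n 0 = g)
    (Frequently.of_forall fun n => ⟨_, rfl⟩)
  have hgg : g ∈ s g := by
    obtain ⟨n, hn⟩ := hg.exists
    obtain ⟨m, hnm, hm⟩ := frequently_atTop.1 hg (n + 1)
    obtain ⟨k, rfl⟩ := Nat.exists_eq_add_of_le hnm
    refine hrec g k ?_
    have hmem := hc.mem_iterate n (k + 1)
    rwa [hn, ← add_assoc, add_right_comm, hm] at hmem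
  refine ⟨g, hc.seqLanguage_eq_orbitLanguage (fun B => ?_) ?_ ?_⟩
  · obtain ⟨n₀, hn₀⟩ := h₀ (-B)
    obtain ⟨n₁, hn₁⟩ := h₁ B
    obtain ⟨n, hn, hng⟩ := frequently_atTop.1 hg (max n₀ n₁)
    have hleft := hc.antitone_cutComp_zero hs (le_of_max_le_left hn)
    have hright := hc.monotone_cutComp_one hs (le_of_max_le_right hn)
    exact ⟨n, 0, [g], rfl, by simpa using hng, hleft.trans hn₀.le,
      by simpa using hn₁.le.trans hright⟩
  · simpa [List.singleton_infix_iff] using hgg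
  · rintro _ rfl
    exact hg.mono fun n hn => mem_seqLanguage.2 ⟨0, by simpa using hn⟩

end IsChain

end Chains

section Stationary

variable {A : Type*} {s : A → List A} {xs : ℕ → ℤ → A} {c : ℕ → ℤ → ℤ} {x y : ℤ → A} {e g : A}
  {f l : A → A} {u v : A → List A} {b : ℤ}

theorem Occurs.isPrefix_block {i : ℤ} {w : List A} (hw : Occurs x i w) {n : ℕ}
    (hn : w.length ≤ n) : w <+: block x i n :=
  (occurs_block x i n).prefix_of_le hw (by simpa using hn)

theorem Desub.singleton_suffix {B : Type*} {φ : B → List A} {y : ℤ → B} {c : ℤ → ℤ}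
    (hd : Desub φ x y c) (h0 : c 0 ≤ 0) (h1 : c 1 = 1) : [x 0] <:+ φ (y 0) := by
  obtain ⟨hlen, hocc⟩ := hd 0
  obtain ⟨m, hm⟩ := Int.le.dest h0
  rw [zero_add, h1] at hlen
  have hφ : (φ (y 0)).length = m + 1 := by omega
  refine ⟨block x (c 0) m, ?_⟩
  rw [← hocc, hφ, block_add, hm, block_one]

theorem exists_eventually_eq_of_monotone {F : ℕ → ℤ} (hF : Monotone F)
    (hB : BddAbove (Set.range F)) : ∃ b, ∀ᶠ n in atTop, F n = b :=
  ⟨_, tendsto_pure.1 (nhds_discrete ℤ ▸ tendsto_atTop_ciSup hF hB)⟩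

/-- The chain is eventually stationary to the right of the origin: the letter at the origin is the
moving letter `g`, whose image ends with `g`, and its iterated images end at position `b`. -/
structure IsRightStationary (s : A → List A) (xs : ℕ → ℤ → A) (c : ℕ → ℤ → ℤ) (g : A) (b : ℤ) :
    Prop where
  not_isFixed : ¬ IsFixed s g
  isSuffix : [g] <:+ s g
  eventually : ∀ᶠ n in atTop, xs n 0 = g ∧ c n 1 = 1 ∧ cutComp c n 1 = b

theorem IsChain.exists_isRightStationary (H : IsSplit s e f l u v) (hc : IsChain s xs c)
    (h0 : ¬ IsFixed s (xs 0 0)) (hB : BddAbove (Set.range fun n => cutComp c n 1)) :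
    ∃ g b, IsRightStationary s xs c g b := by
  have hs := H.head.ne_nil
  obtain ⟨b, hb⟩ := exists_eventually_eq_of_monotone (hc.monotone_cutComp_one hs) hB
  obtain ⟨N, hN⟩ := eventually_atTop.1 hb
  have hone (n : ℕ) (hn : N ≤ n) : c n 1 = 1 :=
    (hc.strictMono_cutComp hs n).injective ((hN (n + 1) (by omega)).trans (hN n hn).symm)
  have hsuffix (n : ℕ) (hn : N ≤ n) : [xs n 0] <:+ s (xs (n + 1) 0) :=
    (hc.desub n).singleton_suffix (hc.zero_nonpos n) (hone n hn)
  have hlast (n : ℕ) (hn : N ≤ n) : xs n 0 = l (xs (n + 1) 0) :=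
    have hmov := hc.not_isFixed h0 (n + 1)
    (suffix_last_unique (hsuffix n hn) (H.isSuffix hmov) (by simp) (H.tail_fixed hmov)
      (hc.not_isFixed h0 n) (H.tail_moving hmov)).2
  have hsucc (n : ℕ) (hn : N ≤ n) : xs (n + 1) 0 = xs n 0 := by
    rw [hlast n hn, hlast (n + 1) (by omega), H.tail_idem]
  have hconst (n : ℕ) (hn : N ≤ n) : xs n 0 = xs N 0 := by
    induction n, hn using Nat.le_induction with
    | base => rfl
    | succ n hn ih => rw [hsucc n hn, ih]
  refine ⟨xs N 0, b, hc.not_isFixed h0 N, ?_, eventually_atTop.2 ⟨N, fun n hn =>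
    ⟨hconst n hn, hone n hn, hN n hn⟩⟩⟩
  simpa only [hsucc N le_rfl] using hsuffix N le_rfl

namespace IsRightStationary

theorem mem (R : IsRightStationary s xs c g b) : g ∈ s g :=
  R.isSuffix.subset List.mem_cons_self

theorem tail_eq_nil (R : IsRightStationary s xs c g b) (H : IsSplit s e f l u v) : v g = [] :=
  (suffix_last_unique R.isSuffix (H.isSuffix R.not_isFixed) (by simp)
    (H.tail_fixed R.not_isFixed) R.not_isFixed (H.tail_moving R.not_isFixed)).1.symm

theorem eventually_cutComp_zero_le (R : IsRightStationary s xs c g b) (hc : IsChain s xs c)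
    (hs : ∀ a, s a ≠ []) (B : ℤ) : ∀ᶠ n in atTop, cutComp c n 0 ≤ B := by
  filter_upwards [R.eventually, eventually_ge_atTop (b - B).toNat] with n ⟨hg, _, hb⟩ hn
  have hone := hc.cutComp_one n
  have hlen := length_lt_length_iterate_wordMap hs R.mem R.not_isFixed n
  rw [hg] at hone
  omega

end IsRightStationary

/-- The word `z` over fixed letters, followed by the moving letter `h`, occurs in `x` right after
the origin. -/
structure IsFirstMoving (s : A → List A) (x : ℤ → A) (z : List A) (h : A) : Prop where
  occurs : Occurs x 1 (z ++ [h])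
  isFixedWord : IsFixedWord s z
  not_isFixed : ¬ IsFixed s h

theorem exists_isFirstMoving {k : ℕ} (hk : ¬ IsFixedWord s (block x 1 k)) :
    ∃ z h, IsFirstMoving s x z h := by
  simp only [IsFixedWord, not_forall] at hk
  obtain ⟨a, ha, hmov⟩ := hk
  obtain ⟨z, h, hz, hfix, hh⟩ := exists_prefix_first ⟨a, ha, hmov⟩
  exact ⟨z, h, (occurs_block x 1 k).of_prefix hz, hfix, hh⟩

theorem Desub.eq_of_isFirstMoving {c : ℤ → ℤ} (H : IsHead s f u) (hd : Desub s x y c)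
    (h1 : c 1 = 1) {z z' : List A} {h h' : A} (hx : IsFirstMoving s x z h)
    (hy : IsFirstMoving s y z' h') : z = z' ++ u h' ∧ h = f h' := by
  obtain ⟨q, hq⟩ := H.isPrefix h' hy.not_isFixed
  have hocc : Occurs x 1 ((z' ++ u h') ++ [f h']) := by
    refine (h1 ▸ (hd.occurs hy.occurs).1).of_prefix ⟨q, ?_⟩
    simp [IsFixedWord.wordMap_eq hy.isFixedWord, ← hq]
  exact prefix_first_unique (hx.occurs.isPrefix_block (le_max_left _ _))
    (hocc.isPrefix_block (le_max_right _ _)) hx.isFixedWord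
    (isFixedWord_append.2 ⟨hy.isFixedWord, H.fixed h' hy.not_isFixed⟩) hx.not_isFixed
    (H.moving h' hy.not_isFixed)

/-- A nonempty `u (h 0)` would make the lengths of the words `z k` decrease forever. -/
theorem eq_nil_of_forall_eq_append (hf : ∀ a, f (f a) = f a) {z : ℕ → List A} {h : ℕ → A}
    (hz : ∀ k, z k = z (k + 1) ++ u (h (k + 1))) (hh : ∀ k, h k = f (h (k + 1))) :
    u (h 0) = [] ∧ f (h 0) = h 0 ∧ ∀ k, z k = z 0 ∧ h k = h 0 := by
  have hconst (k : ℕ) : h k = h 0 := by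
    induction k with
    | zero => rfl
    | succ k ih => rw [← ih, hh k, hh (k + 1), hf]
  have hu : u (h 0) = [] := by
    by_contra hne
    refine not_strictAnti_of_wellFoundedLT (fun k => (z k).length)
      (strictAnti_nat_of_succ_lt fun k => ?_)
    have := List.length_pos_iff.2 hne
    simp only [hz k, hconst, List.length_append]
    omega
  refine ⟨hu, by rw [hh 0, hf], fun k => ⟨?_, hconst k⟩⟩
  induction k with
  | zero => rfl
  | succ k ih => rw [← ih, hz k, hconst (k + 1), hu, List.append_nil]

theorem IsRightStationary.exists_stable (H : IsSplit s e f l u v) (hc : IsChain s xs c)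
    (R : IsRightStationary s xs c g b)
    (hm : ∀ᶠ n in atTop, ∃ k, ¬ IsFixedWord s (block (xs n) 1 k)) :
    ∃ z h, IsFixedWord s z ∧ ¬ IsFixed s h ∧ u h = [] ∧ f h = h ∧
      ∀ᶠ n in atTop, Occurs (xs n) 0 (g :: (z ++ [h])) := by
  obtain ⟨N, hN⟩ := eventually_atTop.1 (R.eventually.and hm)
  have hex (k : ℕ) : ∃ z h, IsFirstMoving s (xs (N + k)) z h :=
    exists_isFirstMoving (hN (N + k) (by omega)).2.choose_spec
  choose z h hzh using hex
  have hstep (k : ℕ) := (hc.desub (N + k)).eq_of_isFirstMoving H.head (hN (N + k) (by omega)).1.2.1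
    (hzh k) (hzh (k + 1))
  obtain ⟨hu, hf, hconst⟩ :=
    eq_nil_of_forall_eq_append H.head_idem (fun k => (hstep k).1) fun k => (hstep k).2
  refine ⟨z 0, h 0, (hzh 0).isFixedWord, (hzh 0).not_isFixed, hu, hf,
    eventually_atTop.2 ⟨N, fun n hn => ?_⟩⟩
  obtain ⟨k, rfl⟩ := Nat.exists_eq_add_of_le hn
  rw [occurs_cons, zero_add, ← (hconst k).1, ← (hconst k).2]
  exact ⟨(hN (N + k) hn).1.1, (hzh k).occurs⟩

theorem IsRightStationary.exists_seqLanguage_eq_of_moving (H : IsSplit s e f l u v)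
    (hc : IsChain s xs c) (hL : ∀ n, seqLanguage (xs n) ⊆ orbitLanguage s {[e]})
    (R : IsRightStationary s xs c g b)
    (hm : ∀ᶠ n in atTop, ∃ k, ¬ IsFixedWord s (block (xs n) 1 k)) :
    ∃ h, ∃ z ∈ gapCenters s u v, seqLanguage (xs 0) = orbitLanguage s {g :: (z ++ [h])} := by
  obtain ⟨z, h, hz, hh, hu, hf, hocc⟩ := R.exists_stable H hc hm
  have hs := H.head.ne_nil
  have hpre : [h] <+: s h := by simpa [hu, hf] using H.head.isPrefix h hh
  have hcenter : z ∈ gapCenters s u v := by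
    obtain ⟨n, hn⟩ := hocc.exists
    obtain ⟨z', hz', k, hk⟩ := H.exists_gap_eq ⟨R.not_isFixed, hz, hh⟩ (hL n hn.mem_seqLanguage)
    rw [R.tail_eq_nil H, hu, wordPow_nil, List.append_nil, List.nil_append] at hk
    exact hk ▸ hz'
  refine ⟨h, z, hcenter, hc.seqLanguage_eq_orbitLanguage (fun B => ?_) ?_ ?_⟩
  · obtain ⟨n, hn, hleft, ⟨hg, -, hb⟩, hnB⟩ := (hocc.and <|
      (R.eventually_cutComp_zero_le hc hs (-B)).and <|
      R.eventually.and (eventually_ge_atTop (B - b).toNat)).exists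
    refine ⟨n, 0, _, rfl, hn, hleft, ?_⟩
    rw [(hc.occurs_iterate n hn).2, ← List.singleton_append, iterate_wordMap_append,
      iterate_wordMap_append]
    have hone := hc.cutComp_one n
    have hlen := length_lt_length_iterate_wordMap hs (hpre.subset List.mem_cons_self) hh n
    rw [hg] at hone
    simp only [List.length_append]
    omega
  · rintro _ rfl
    obtain ⟨p, hp⟩ := R.isSuffix
    obtain ⟨q, hq⟩ := hpre
    exact ⟨p, q, by simp [← hp, ← hq, IsFixedWord.wordMap_eq hz]⟩
  · rintro _ rfl
    exact hocc.frequently.mono fun n hn => hn.mem_seqLanguage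

theorem Desub.block_eq_of_isFixedWord {c : ℤ → ℤ} (H : IsHead s f u) (hd : Desub s x y c)
    (h1 : c 1 = 1) (hx : ∀ k, IsFixedWord s (block x 1 k)) (k : ℕ) :
    block y 1 k = block x 1 k := by
  have hocc := h1 ▸ (hd.occurs (occurs_block y 1 k)).1
  have hfix : IsFixedWord s (block y 1 k) := by
    intro b hb
    by_contra hmov
    have hmem : f b ∈ wordMap s (block y 1 k) :=
      mem_wordMap.2 ⟨b, hb, (H.isPrefix b hmov).subset (by simp)⟩
    rw [← hocc] at hmem
    exact H.moving b hmov (hx _ _ hmem)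
  rw [IsFixedWord.wordMap_eq hfix] at hocc
  simpa [Occurs] using hocc.symm

theorem IsRightStationary.exists_eventually_block_eq (H : IsHead s f u) (hc : IsChain s xs c)
    (R : IsRightStationary s xs c g b)
    (hm : ∃ᶠ n in atTop, ∀ k, IsFixedWord s (block (xs n) 1 k)) :
    ∃ M, (∀ k, IsFixedWord s (block (xs M) 1 k)) ∧
      ∀ᶠ n in atTop, ∀ k, Occurs (xs n) 0 (g :: block (xs M) 1 k) := by
  obtain ⟨N, hN⟩ := eventually_atTop.1 R.eventually
  obtain ⟨M, hNM, hM⟩ := frequently_atTop.1 hm N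
  have hblock (n : ℕ) (hn : M ≤ n) : ∀ k, block (xs n) 1 k = block (xs M) 1 k := by
    induction n, hn using Nat.le_induction with
    | base => exact fun k => rfl
    | succ n hn ih =>
      intro k
      rw [← ih k]
      exact (hc.desub n).block_eq_of_isFixedWord H (hN n (by omega)).2.1 (by simpa only [ih]) k
  refine ⟨M, hM, eventually_atTop.2 ⟨M, fun n hn k => ?_⟩⟩
  rw [occurs_cons, zero_add, ← hblock n hn k]
  exact ⟨(hN n (by omega)).1, occurs_block _ _ _⟩

theorem IsSplit.exists_forall_block_prefix [Finite A] (H : IsSplit s e f l u v)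
    (hg : ¬ IsFixed s g) (hv : v g = []) (hfix : ∀ k, IsFixedWord s (block x 1 k))
    (hx : ∀ k, g :: block x 1 k ∈ orbitLanguage s {[e]}) :
    ∃ h, ∃ z ∈ gapCenters s u v, ∀ k, ∃ i, block x 1 k <+: z ++ wordPow (u h) i := by
  have := (finite_gapCenters s u v).to_subtype
  have hex (k : ℕ) : ∃ p : A × gapCenters s u v, ∃ i, block x 1 k <+: p.2 ++ wordPow (u p.1) i := by
    obtain ⟨q, h, hgap, hmem⟩ := H.exists_gap_right hg (hfix k) (hx k)
    obtain ⟨z, hz, i, hi⟩ := H.exists_gap_eq hgap hmem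
    rw [hv, wordPow_nil, List.nil_append] at hi
    exact ⟨(h, ⟨z, hz⟩), i, q, hi⟩
  obtain ⟨⟨h, z, hz⟩, hfreq⟩ := exists_frequently_of_finite (l := atTop) (Frequently.of_forall hex)
  refine ⟨h, z, hz, fun k => ?_⟩
  obtain ⟨m, hkm, i, hi⟩ := frequently_atTop.1 hfreq k
  refine ⟨i, List.IsPrefix.trans ?_ hi⟩
  exact (occurs_block x 1 k).isPrefix_block (by simpa using hkm)

theorem occurs_of_forall_block_prefix {i : ℤ} {z w : List A}
    (h : ∀ k, ∃ j, block x i k <+: z ++ wordPow w j) (j : ℕ) : Occurs x i (z ++ wordPow w j) := by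
  have hmono (m n : ℕ) : z ++ wordPow w m <+: z ++ wordPow w (m + n) := by
    rw [wordPow_add, ← List.append_assoc]
    exact List.prefix_append _ _
  obtain ⟨m, hm⟩ := h (z ++ wordPow w j).length
  exact (List.prefix_of_prefix_length_le (hm.trans (hmono m j)) (add_comm j m ▸ hmono j m)
    (by simp)).eq_of_length (by simp)

theorem IsRightStationary.exists_seqLanguage_eq_of_fixed [Finite A] (H : IsSplit s e f l u v)
    (hc : IsChain s xs c) (hL : ∀ n, seqLanguage (xs n) ⊆ orbitLanguage s {[e]})
    (R : IsRightStationary s xs c g b)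
    (hm : ∃ᶠ n in atTop, ∀ k, IsFixedWord s (block (xs n) 1 k)) :
    ∃ h, ∃ z ∈ gapCenters s u v, seqLanguage (xs 0) =
      orbitLanguage s (Set.range fun i => g :: (z ++ wordPow (u h) i)) := by
  have hs := H.head.ne_nil
  obtain ⟨M, hM, hev⟩ := R.exists_eventually_block_eq H.head hc hm
  obtain ⟨n₀, hn₀⟩ := hev.exists
  obtain ⟨h, z, hz, hpre⟩ := H.exists_forall_block_prefix R.not_isFixed (R.tail_eq_nil H) hM
    fun k => hL n₀ (hn₀ k).mem_seqLanguage
  have hblock (i : ℕ) : block (xs M) 1 (z ++ wordPow (u h) i).length = z ++ wordPow (u h) i :=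
    occurs_of_forall_block_prefix hpre i
  have hocc : ∀ᶠ n in atTop, ∀ i, Occurs (xs n) 0 (g :: (z ++ wordPow (u h) i)) :=
    hev.mono fun n hn i => hblock i ▸ hn _
  refine ⟨h, z, hz, hc.seqLanguage_eq_orbitLanguage (fun B => ?_) ?_ ?_⟩
  · obtain ⟨n, hn, hleft, hg, -, hb⟩ := (hocc.and <|
      (R.eventually_cutComp_zero_le hc hs (-B)).and R.eventually).exists
    obtain ⟨i, hi⟩ := hpre (B - b).toNat
    refine ⟨n, 0, _, ⟨i, rfl⟩, hn i, hleft, ?_⟩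
    rw [(hc.occurs_iterate n (hn i)).2, ← List.singleton_append, iterate_wordMap_append]
    have hone := hc.cutComp_one n
    have hlen := length_le_length_iterate_wordMap hs n (z ++ wordPow (u h) i)
    have hle := hi.length_le
    rw [length_block] at hle
    rw [hg] at hone
    rw [List.length_append]
    omega
  · rintro _ ⟨i, rfl⟩
    obtain ⟨p, hp⟩ := R.isSuffix
    have hfix : IsFixedWord s (z ++ wordPow (u h) i) := hblock i ▸ hM _
    exact ⟨p, [], by simp only [wordMap_cons, hfix.wordMap_eq, ← hp]; simp⟩
  · rintro _ ⟨i, rfl⟩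
    exact hocc.frequently.mono fun n hn => (hn i).mem_seqLanguage

/-- The languages of the sequences with a chain of desubstitutions in `orbitLanguage s {e}` whose
intervals around the origin are bounded on the right. -/
def rightBoundedLanguages (s : A → List A) (e : A) : Set (Set (List A)) :=
  {K | ∃ xs c, IsChain s xs c ∧ (∀ n, seqLanguage (xs n) ⊆ orbitLanguage s {[e]}) ∧
    ¬ IsFixed s (xs 0 0) ∧ BddAbove (Set.range fun n => cutComp c n 1) ∧ K = seqLanguage (xs 0)}

theorem IsSplit.finite_rightBoundedLanguages [Finite A] (H : IsSplit s e f l u v) :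
    (rightBoundedLanguages s e).Finite := by
  have := (finite_gapCenters s u v).to_subtype
  let moving (p : A × A × gapCenters s u v) := orbitLanguage s {p.1 :: (p.2.2 ++ [p.2.1])}
  let fixed (p : A × A × gapCenters s u v) :=
    orbitLanguage s (Set.range fun i => p.1 :: (p.2.2 ++ wordPow (u p.2.1) i))
  refine ((Set.finite_range moving).union (Set.finite_range fixed)).subset ?_
  rintro _ ⟨xs, c, hc, hL, h0, hB, rfl⟩
  obtain ⟨g, b, R⟩ := hc.exists_isRightStationary H h0 hB
  by_cases hm : ∃ᶠ n in atTop, ∀ k, IsFixedWord s (block (xs n) 1 k)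
  · obtain ⟨h, z, hz, heq⟩ := R.exists_seqLanguage_eq_of_fixed H hc hL hm
    exact Or.inr ⟨(g, h, ⟨z, hz⟩), heq.symm⟩
  · simp only [not_frequently, not_forall] at hm
    obtain ⟨h, z, hz, heq⟩ := R.exists_seqLanguage_eq_of_moving H hc hL hm
    exact Or.inl ⟨(g, h, ⟨z, hz⟩), heq.symm⟩

end Stationary

section Reversal

variable {A : Type*} {s : A → List A} {e : A} {f l : A → A} {u v : A → List A}

theorem semiconj_reverse (s : A → List A) :
    Function.Semiconj List.reverse (wordMap s) (wordMap (revMap s)) := fun w => by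
  induction w with
  | nil => rfl
  | cons a w ih => simp [← ih, revMap]

theorem iterate_revMap_singleton (s : A → List A) (n : ℕ) (a : A) :
    (wordMap (revMap s))^[n] [a] = ((wordMap s)^[n] [a]).reverse :=
  ((semiconj_reverse s).iterate_right n [a]).symm

theorem reverse_mem_orbitLanguage {t : List A} (ht : t ∈ orbitLanguage s {[e]}) :
    t.reverse ∈ orbitLanguage (revMap s) {[e]} := by
  obtain ⟨n, _, rfl, hn⟩ := ht
  refine ⟨n, [e], rfl, ?_⟩
  rw [iterate_revMap_singleton]
  exact List.reverse_infix.2 hn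

theorem Occurs.reverse {x : ℤ → A} {i : ℤ} {w : List A} (h : Occurs x i w) :
    Occurs (fun j => x (-j)) (1 - i - w.length) w.reverse := by
  induction w generalizing i with
  | nil => simp
  | cons a w ih =>
    rw [occurs_cons] at h
    rw [List.reverse_cons, occurs_append, occurs_singleton, List.length_reverse,
      List.length_cons, ← h.1]
    push_cast
    refine ⟨?_, by congr 1; ring⟩
    convert ih h.2 using 1
    ring

theorem seqLanguage_neg (x : ℤ → A) :
    seqLanguage (fun j => x (-j)) = List.reverse '' seqLanguage x := by
  have hreverse (x : ℤ → A) {w : List A} (hw : w ∈ seqLanguage x) :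
      w.reverse ∈ seqLanguage fun j => x (-j) := by
    obtain ⟨i, hi⟩ := mem_seqLanguage.1 hw
    exact hi.reverse.mem_seqLanguage
  refine Set.Subset.antisymm (fun t ht => ⟨t.reverse, ?_, t.reverse_reverse⟩) ?_
  · simpa only [neg_neg] using hreverse _ ht
  · rintro _ ⟨w, hw, rfl⟩
    exact hreverse x hw

theorem IsSplit.reverse (H : IsSplit s e f l u v) :
    IsSplit (revMap s) e l f (fun g => (v g).reverse) fun g => (u g).reverse where
  head := H.tail
  tail := by simpa only [revMap_revMap, List.reverse_reverse] using H.head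
  head_idem := H.tail_idem
  tail_idem := H.head_idem
  seed := by
    obtain ⟨m, hm⟩ := H.seed
    exact ⟨m.reverse, by simp [revMap, hm]⟩
  recurrent g n hg := by
    rw [iterate_revMap_singleton, List.mem_reverse] at hg
    exact List.mem_reverse.2 (H.recurrent g n hg)

theorem IsChain.reverse {xs : ℕ → ℤ → A} {c : ℕ → ℤ → ℤ} (hc : IsChain s xs c) :
    IsChain (revMap s) (fun n j => xs n (-j)) (fun n i => 1 - c n (1 - i)) where
  desub n i := by
    obtain ⟨hlen, hocc⟩ := hc.desub n (-i)
    rw [neg_add_eq_sub] at hlen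
    have hlen' : 1 - (i + 1) = -i := by ring
    refine ⟨?_, ?_⟩
    · simp only [hlen', hlen, revMap, List.length_reverse]
      ring
    · simpa only [hlen, sub_add_eq_sub_sub, sub_right_comm, revMap] using hocc.reverse
  zero_nonpos n := by
    have := hc.one_pos n
    simp only [sub_zero]
    omega
  one_pos n := by
    have := hc.zero_nonpos n
    simp only [sub_self]
    omega

theorem cutComp_reverse (c : ℕ → ℤ → ℤ) (n : ℕ) (i : ℤ) :
    cutComp (fun n i => 1 - c n (1 - i)) n i = 1 - cutComp c n (1 - i) := by
  induction n generalizing i with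
  | zero => simp [cutComp]
  | succ n ih => simp [cutComp, ih]

theorem IsChain.seqLanguage_mem_of_bddBelow {xs : ℕ → ℤ → A} {c : ℕ → ℤ → ℤ}
    (hc : IsChain s xs c) (hL : ∀ n, seqLanguage (xs n) ⊆ orbitLanguage s {[e]})
    (h0 : ¬ IsFixed s (xs 0 0)) (hB : BddBelow (Set.range fun n => cutComp c n 0)) :
    seqLanguage (xs 0) ∈ Set.image List.reverse '' rightBoundedLanguages (revMap s) e := by
  refine ⟨_, ⟨_, _, hc.reverse, fun n => ?_, by simpa using h0, ?_, rfl⟩, ?_⟩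
  · rw [seqLanguage_neg]
    rintro _ ⟨t, ht, rfl⟩
    exact reverse_mem_orbitLanguage (hL n ht)
  · obtain ⟨B, hB⟩ := hB
    refine ⟨1 - B, ?_⟩
    rintro _ ⟨n, rfl⟩
    have : B ≤ cutComp c n 0 := hB ⟨n, rfl⟩
    simp only [cutComp_reverse, sub_self]
    omega
  · rw [seqLanguage_neg, Set.image_image]
    simp

theorem seqLanguage_shift (x : ℤ → A) (i : ℤ) :
    seqLanguage (fun j => x (i + j)) = seqLanguage x := by
  refine Set.Subset.antisymm ?_ ?_
  · rintro _ ⟨j, n, rfl⟩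
    exact ⟨i + j, n, by simp only [block, add_assoc]⟩
  · rintro _ ⟨j, n, rfl⟩
    exact ⟨j - i, n, by simp only [block, ← add_assoc, add_sub_cancel]⟩

theorem IsSplit.exists_infix_wordMap (H : IsSplit s e f l u v) {t : List A}
    (ht : t ∈ orbitLanguage s {[e]}) : ∃ w ∈ orbitLanguage s {[e]}, t <:+: wordMap s w := by
  obtain ⟨n, _, rfl, hn⟩ := ht
  obtain ⟨m, hm⟩ := H.seed
  have he : [e] <:+: wordMap s [e] := ⟨[], m ++ [e], by simp [hm]⟩
  refine ⟨_, ⟨n, [e], rfl, List.infix_rfl⟩, ?_⟩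
  rw [← Function.iterate_succ_apply' (wordMap s)]
  exact hn.trans (iterate_wordMap_infix_of_le he n.le_succ)

theorem IsSplit.finite_languagesIn [Finite A] (H : IsSplit s e f l u v) :
    (languagesIn (orbitLanguage s {[e]})).Finite := by
  have hfin := (H.finite_languages_of_isFixed.union
    (Set.finite_range fun g => orbitLanguage s {[g]})).union
    (H.finite_rightBoundedLanguages.union
      (H.reverse.finite_rightBoundedLanguages.image (Set.image List.reverse)))
  refine hfin.subset ?_
  rintro _ ⟨x, hx, rfl⟩
  by_cases hfix : ∀ i, IsFixed s (x i)
  · exact Or.inl (Or.inl ⟨x, hx, hfix, rfl⟩)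
  push Not at hfix
  obtain ⟨i, hi⟩ := hfix
  rw [← seqLanguage_shift x i] at hx ⊢
  obtain ⟨xs, c, hc, hL, h0⟩ := exists_isChain (isFactorial_orbitLanguage s _)
    (fun t ht => H.exists_infix_wordMap ht) hx
  rw [← h0]
  have hmov : ¬ IsFixed s (xs 0 0) := by simpa [h0] using hi
  by_cases hright : BddAbove (Set.range fun n => cutComp c n 1)
  · exact Or.inr (Or.inl ⟨xs, c, hc, hL, hmov, hright, rfl⟩)
  by_cases hleft : BddBelow (Set.range fun n => cutComp c n 0)
  · exact Or.inr (Or.inr (hc.seqLanguage_mem_of_bddBelow hL hmov hleft))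
  simp only [not_bddAbove_iff, not_bddBelow_iff, Set.exists_range_iff] at hright hleft
  obtain ⟨g, hg⟩ := hc.exists_seqLanguage_eq_of_exhausting H.head.ne_nil H.recurrent hleft hright
  exact Or.inl (Or.inr ⟨g, hg.symm⟩)

end Reversal

section IdempotentPower

theorem eventually_iterate_factorial_idempotent {X : Type*} {f : X → X} {x : X} {i j : ℕ}
    (hij : i < j) (h : f^[i] x = f^[j] x) :
    ∀ᶠ n : ℕ in atTop, f^[n.factorial] (f^[n.factorial] x) = f^[n.factorial] x := by
  obtain ⟨d, hd, rfl⟩ := exists_pos_add_of_lt' hij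
  have hperiodic : Function.IsPeriodicPt f d (f^[i] x) := by
    rw [Function.IsPeriodicPt, Function.IsFixedPt, ← Function.iterate_add_apply, add_comm, ← h]
  filter_upwards [eventually_ge_atTop (i + d)] with n hn
  have hle : i ≤ n.factorial := by have := n.self_le_factorial; omega
  obtain ⟨m, hm⟩ := Nat.dvd_factorial hd (by omega : d ≤ n)
  have hfact : Function.IsPeriodicPt f n.factorial (f^[n.factorial - i] (f^[i] x)) :=
    hm ▸ (hperiodic.apply_iterate _).mul_const m
  rwa [← Function.iterate_add_apply, Nat.sub_add_cancel hle] at hfact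

theorem exists_iterate_idempotent {X : Type*} [Finite X] (f : X → X) :
    ∃ p > 0, ∀ x, f^[p] (f^[p] x) = f^[p] x := by
  have hev (x : X) : ∀ᶠ n : ℕ in atTop,
      f^[n.factorial] (f^[n.factorial] x) = f^[n.factorial] x := by
    obtain ⟨i, j, hne, heq⟩ := Finite.exists_ne_map_eq_of_infinite fun n => f^[n] x
    rcases hne.lt_or_gt with h | h
    · exact eventually_iterate_factorial_idempotent h heq
    · exact eventually_iterate_factorial_idempotent h heq.symm
  obtain ⟨n, hn⟩ := (eventually_all.2 hev).exists
  exact ⟨n.factorial, n.factorial_pos, hn⟩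

end IdempotentPower

section PowMap

variable {A : Type*} {s : A → List A} {e a : A} {q : ℕ}

/-- The map on letters defining the `q`-th power of the morphism `wordMap s`. -/
def powMap (s : A → List A) (q : ℕ) (a : A) : List A :=
  (wordMap s)^[q] [a]

theorem wordMap_powMap (s : A → List A) (q : ℕ) : wordMap (powMap s q) = (wordMap s)^[q] :=
  (iterate_wordMap_eq s q).symm

theorem iterate_wordMap_powMap (s : A → List A) (q n : ℕ) :
    (wordMap (powMap s q))^[n] = (wordMap s)^[q * n] := by
  rw [wordMap_powMap, Function.iterate_mul]

theorem revMap_powMap (s : A → List A) (q : ℕ) : revMap (powMap s q) = powMap (revMap s) q :=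
  funext fun a => (iterate_revMap_singleton s q a).symm

theorem IsFixed.iterate_wordMap (h : IsFixed s a) (n : ℕ) : (wordMap s)^[n] [a] = [a] :=
  Function.iterate_fixed (IsFixedWord.wordMap_eq (by simpa [IsFixedWord] using h)) n

theorem exists_powMap_eq_seed (he : ∃ m, s e = e :: (m ++ [e])) (hq : 0 < q) :
    ∃ m, powMap s q e = e :: (m ++ [e]) := by
  obtain ⟨m, hm⟩ := he
  induction q, hq using Nat.le_induction with
  | base => exact ⟨m, by simpa [powMap] using hm⟩
  | succ q _ ih =>
    obtain ⟨m', hm'⟩ := ih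
    refine ⟨m ++ e :: (wordMap s m' ++ e :: m), ?_⟩
    simp only [powMap] at hm'
    simp [powMap, Function.iterate_succ_apply', hm', hm, -Function.iterate_succ]

theorem orbitLanguage_subset_powMap (he : ∃ m, s e = e :: (m ++ [e])) (hq : 0 < q) :
    orbitLanguage s {[e]} ⊆ orbitLanguage (powMap s q) {[e]} := by
  obtain ⟨m, hm⟩ := he
  rintro t ⟨n, _, rfl, ht⟩
  refine ⟨n, [e], rfl, ht.trans ?_⟩
  rw [iterate_wordMap_powMap]
  exact iterate_wordMap_infix_of_le ⟨[], m ++ [e], by simp [hm]⟩ (Nat.le_mul_of_pos_left n hq)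

/-- The letters occurring in the images under `s` of the letters of `U`. -/
def imageLetters (s : A → List A) (U : Set A) : Set A :=
  {b | ∃ a ∈ U, b ∈ s a}

theorem iterate_imageLetters_singleton (s : A → List A) (n : ℕ) (a : A) :
    (imageLetters s)^[n] {a} = {b | b ∈ (wordMap s)^[n] [a]} := by
  induction n with
  | zero => simp
  | succ n ih =>
    ext b
    simp [Function.iterate_succ_apply', ih, imageLetters, mem_wordMap, -Function.iterate_succ]

theorem mem_powMap_of_mem_iterate (hq : ∀ U, (imageLetters s)^[q] ((imageLetters s)^[q] U) =
    (imageLetters s)^[q] U) {n : ℕ} (ha : a ∈ (wordMap (powMap s q))^[n + 1] [a]) :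
    a ∈ powMap s q a := by
  have hpow : (imageLetters s)^[q * (n + 1)] {a} = (imageLetters s)^[q] {a} := by
    rw [Function.iterate_mul, Function.iterate_succ_apply]
    exact Function.iterate_fixed (hq {a}) n
  rw [iterate_imageLetters_singleton, iterate_imageLetters_singleton] at hpow
  rw [iterate_wordMap_powMap] at ha
  exact hpow.subset ha

end PowMap

section Tame

variable {A : Type*} {s : A → List A} {e : A} {f : A → A} {u : A → List A}

/-- Every letter is fixed by `s` or keeps producing moving letters without ever returning to
itself alone. -/
structure IsTame (s : A → List A) : Prop where
  exists_moving : ∀ a, ¬ IsFixed s a → ∃ b ∈ s a, ¬ IsFixed s b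
  isFixed_of_iterate : ∀ a n, (wordMap s)^[n + 1] [a] = [a] → IsFixed s a

theorem IsTame.reverse (H : IsTame s) : IsTame (revMap s) where
  exists_moving a ha := by
    simpa [revMap] using H.exists_moving a (by simpa using ha)
  isFixed_of_iterate a n h := by
    rw [iterate_revMap_singleton, List.reverse_eq_iff] at h
    exact isFixed_revMap.2 (H.isFixed_of_iterate a n h)

theorem IsTame.isFixed_powMap (H : IsTame s) {q : ℕ} (hq : 0 < q) {a : A} :
    IsFixed (powMap s q) a ↔ IsFixed s a := by
  obtain ⟨n, rfl⟩ := Nat.exists_eq_add_one.2 hq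
  exact ⟨H.isFixed_of_iterate a n, fun h => h.iterate_wordMap (n + 1)⟩

theorem IsTame.exists_isHead (H : IsTame s) : ∃ f u, IsHead s f u := by
  have hfirst (g : A) : ∃ (h : A) (t : List A), ¬ IsFixed s g →
      IsFixedWord s t ∧ ¬ IsFixed s h ∧ t ++ [h] <+: s g := by
    by_cases hg : IsFixed s g
    · exact ⟨g, [], fun h => absurd hg h⟩
    · obtain ⟨t, h, htg, ht, hh⟩ := exists_prefix_first (H.exists_moving g hg)
      exact ⟨h, t, fun _ => ⟨ht, hh, htg⟩⟩
  choose f u hfu using hfirst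
  exact ⟨f, u, fun g hg => (hfu g hg).1, fun g hg => (hfu g hg).2.1, fun g hg => (hfu g hg).2.2⟩

theorem IsHead.exists_prefix_iterate (H : IsHead s f u) {g : A} (hg : ¬ IsFixed s g) (n : ℕ) :
    ∃ t, IsFixedWord s t ∧ ¬ IsFixed s (f^[n] g) ∧ t ++ [f^[n] g] <+: (wordMap s)^[n] [g] := by
  induction n with
  | zero => exact ⟨[], by simp [IsFixedWord], hg, by simp⟩
  | succ n ih =>
    obtain ⟨t, ht, hmov, r, hr⟩ := ih
    obtain ⟨r', hr'⟩ := H.isPrefix _ hmov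
    rw [Function.iterate_succ_apply', Function.iterate_succ_apply', ← hr]
    exact ⟨t ++ u (f^[n] g), isFixedWord_append.2 ⟨ht, H.fixed _ hmov⟩, H.moving _ hmov,
      r' ++ wordMap s r, by simp [ht.wordMap_eq, ← hr']⟩

theorem IsHead.exists_powMap (H : IsHead s f u) (hs : IsTame s) {q : ℕ} (hq : 0 < q) :
    ∃ u', IsHead (powMap s q) f^[q] u' := by
  have hpow (g : A) : ∃ t, ¬ IsFixed s g →
      IsFixedWord s t ∧ ¬ IsFixed s (f^[q] g) ∧ t ++ [f^[q] g] <+: powMap s q g := by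
    by_cases hg : IsFixed s g
    · exact ⟨[], fun h => absurd hg h⟩
    · obtain ⟨t, ht⟩ := H.exists_prefix_iterate hg q
      exact ⟨t, fun _ => ht⟩
  choose u' hu' using hpow
  refine ⟨u', ?_, ?_, ?_⟩ <;> simp only [IsFixedWord, hs.isFixed_powMap hq] <;> intro g hg
  · exact (hu' g hg).1
  · exact (hu' g hg).2.1
  · exact (hu' g hg).2.2

theorem IsTame.exists_isSplit_powMap [Finite A] (H : IsTame s)
    (he : ∃ m, s e = e :: (m ++ [e])) :
    ∃ q > 0, ∃ f l u v, IsSplit (powMap s q) e f l u v := by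
  obtain ⟨f, u, hf⟩ := H.exists_isHead
  obtain ⟨l, v, hl⟩ := H.reverse.exists_isHead
  obtain ⟨q, hq, hidem⟩ := exists_iterate_idempotent (Prod.map f (Prod.map l (imageLetters s)))
  simp only [Prod.map_iterate, Prod.forall, Prod.map_apply, Prod.mk.injEq] at hidem
  obtain ⟨u', hu'⟩ := hf.exists_powMap H hq
  obtain ⟨v', hv'⟩ := hl.exists_powMap H.reverse hq
  refine ⟨q, hq, f^[q], l^[q], u', fun g => (v' g).reverse, hu', ?_, fun g => (hidem g g ∅).1,
    fun g => (hidem g g ∅).2.1, exists_powMap_eq_seed he hq, fun g n hg =>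
    mem_powMap_of_mem_iterate (fun U => (hidem g g U).2.2) hg⟩
  simpa only [revMap_powMap, List.reverse_reverse] using hv'

theorem IsTame.finite_languagesIn_seed [Finite A] (H : IsTame s)
    (he : ∃ m, s e = e :: (m ++ [e])) : (languagesIn (orbitLanguage s {[e]})).Finite := by
  obtain ⟨q, hq, f, l, u, v, hsplit⟩ := H.exists_isSplit_powMap he
  refine hsplit.finite_languagesIn.subset ?_
  rintro _ ⟨x, hx, rfl⟩
  exact ⟨x, hx.trans (orbitLanguage_subset_powMap he hq), rfl⟩

end Tame

section Seed

variable {A : Type*} {s : A → List A} {w : List A}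

/-- The extension of a morphism to an alphabet with one more letter `none`, which is a seed
producing the word `w`. -/
def seedMap (s : A → List A) (w : List A) : Option A → List (Option A)
  | none => none :: (w.map some ++ [none])
  | some a => (s a).map some

theorem seedMap_none (s : A → List A) (w : List A) :
    ∃ m, seedMap s w none = none :: (m ++ [none]) :=
  ⟨w.map some, rfl⟩

theorem semiconj_map_some (s : A → List A) (w : List A) :
    Function.Semiconj (List.map some) (wordMap s) (wordMap (seedMap s w)) := fun v => by
  simp [wordMap, seedMap, List.map_flatMap, List.flatMap_map]

theorem isTame_seedMap (H : IsTame s) (w : List A) : IsTame (seedMap s w) where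
  exists_moving := by
    rintro (_ | a) ha
    · exact ⟨none, by simp [seedMap], ha⟩
    · obtain ⟨b, hb, hmov⟩ := H.exists_moving a fun h => ha <| by
        rw [IsFixed] at h
        simp [IsFixed, seedMap, h]
      refine ⟨some b, by simpa [seedMap] using hb, fun h => hmov ?_⟩
      simpa [IsFixed, seedMap, List.map_eq_singleton_iff] using h
  isFixed_of_iterate := by
    rintro (_ | a) n h
    · obtain ⟨m, hm⟩ := exists_powMap_eq_seed (seedMap_none s w) n.succ_pos
      simp [powMap, h] at hm
    · have hsome := (semiconj_map_some s w).iterate_right (n + 1) [a]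
      rw [List.map_singleton, h, ← List.map_singleton] at hsome
      have := H.isFixed_of_iterate a n (List.map_injective_iff.2 (Option.some_injective A) hsome)
      rw [IsFixed] at this
      simp [IsFixed, seedMap, this]

theorem map_some_mem_orbitLanguage {t : List A} (ht : t ∈ orbitLanguage s {w}) :
    t.map some ∈ orbitLanguage (seedMap s w) {[none]} := by
  obtain ⟨n, v, rfl, hn⟩ := ht
  have hv : v.map some <:+: wordMap (seedMap s v) [none] :=
    ⟨[none], [none], by simp [seedMap]⟩
  refine ⟨n + 1, [none], rfl, (hn.map some).trans ?_⟩
  rw [(semiconj_map_some s v).iterate_right n, Function.iterate_succ_apply]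
  exact iterate_wordMap_infix _ n hv

theorem seqLanguage_comp {B : Type*} (f : A → B) (x : ℤ → A) :
    seqLanguage (f ∘ x) = List.map f '' seqLanguage x := by
  ext t
  constructor
  · rintro ⟨i, n, rfl⟩
    exact ⟨_, ⟨i, n, rfl⟩, List.map_ofFn ..⟩
  · rintro ⟨_, ⟨i, n, rfl⟩, rfl⟩
    exact ⟨i, n, List.map_ofFn ..⟩

theorem IsTame.finite_languagesIn_singleton [Finite A] (H : IsTame s) (w : List A) :
    (languagesIn (orbitLanguage s {w})).Finite := by
  refine (((isTame_seedMap H w).finite_languagesIn_seed (seedMap_none s w)).image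
    fun K => List.map some ⁻¹' K).subset ?_
  rintro _ ⟨x, hx, rfl⟩
  refine ⟨_, ⟨some ∘ x, ?_, rfl⟩, ?_⟩
  · rw [seqLanguage_comp, Set.image_subset_iff]
    exact fun t ht => map_some_mem_orbitLanguage (hx ht)
  · rw [seqLanguage_comp]
    exact Set.preimage_image_eq _ (List.map_injective_iff.2 (Option.some_injective A))

theorem IsTame.finite_languagesIn [Finite A] (H : IsTame s) {S : Set (List A)} (hS : S.Finite) :
    (languagesIn (orbitLanguage s S)).Finite := by
  have := hS.to_subtype
  have hunion : orbitLanguage s S = ⋃ w : S, orbitLanguage s {w.1} := by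
    ext t
    simp only [orbitLanguage, Set.mem_ofPred_eq, Set.mem_iUnion, Set.mem_singleton_iff,
      exists_eq_left, Subtype.exists, exists_prop]
    exact ⟨fun ⟨n, w, hw, ht⟩ => ⟨w, hw, n, ht⟩, fun ⟨w, hw, n, ht⟩ => ⟨n, w, hw, ht⟩⟩
  rw [hunion]
  exact finite_languagesIn_iUnion (fun w => isFactorial_orbitLanguage s _)
    fun w => H.finite_languagesIn_singleton w.1

end Seed

section Bounded

variable {A : Type*} {s τ : A → List A} {a : A}

/-- The iterated images of the letter `a` are eventually periodic. Over a finite alphabet this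
says that their lengths are bounded. -/
def IsBounded (s : A → List A) (a : A) : Prop :=
  ∃ i j, i < j ∧ (wordMap s)^[i] [a] = (wordMap s)^[j] [a]

theorem IsBounded.of_powMap {p : ℕ} (hp : 0 < p) (h : IsBounded (powMap s p) a) :
    IsBounded s a := by
  obtain ⟨i, j, hij, heq⟩ := h
  rw [iterate_wordMap_powMap, iterate_wordMap_powMap] at heq
  exact ⟨p * i, p * j, Nat.mul_lt_mul_of_pos_left hij hp, heq⟩

/-- Every bounded letter has an image which is fixed by the morphism. -/
def IsBoundedIdempotent (τ : A → List A) : Prop :=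
  ∀ a, IsBounded τ a → wordMap τ (τ a) = τ a

theorem exists_isBoundedIdempotent_powMap [Finite A] (s : A → List A) :
    ∃ p > 0, IsBoundedIdempotent (powMap s p) := by
  have hev : ∀ᶠ n : ℕ in atTop, ∀ a, IsBounded s a →
      (wordMap s)^[n.factorial] ((wordMap s)^[n.factorial] [a]) =
        (wordMap s)^[n.factorial] [a] := by
    simp only [eventually_all]
    rintro a ⟨i, j, hij, h⟩
    exact eventually_iterate_factorial_idempotent hij h
  obtain ⟨n, hn⟩ := hev.exists
  refine ⟨n.factorial, n.factorial_pos, fun a ha => ?_⟩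
  rw [wordMap_powMap]
  exact hn a (ha.of_powMap n.factorial_pos)

theorem IsBoundedIdempotent.isBounded_of_forall_mem (H : IsBoundedIdempotent τ)
    (h : ∀ b ∈ τ a, IsBounded τ b) : IsBounded τ a := by
  refine ⟨2, 3, by norm_num, ?_⟩
  have : wordMap τ (wordMap τ (τ a)) = wordMap τ (τ a) := by
    rw [wordMap_wordMap]
    exact wordMap_congr fun b hb => H b (h b hb)
  simpa using this.symm

end Bounded

section Reduction

variable {A : Type*} {s τ : A → List A} {S : Set (List A)}

theorem isBounded_of_eq_nil {a : A} (h : τ a = []) : IsBounded τ a :=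
  ⟨1, 2, by norm_num, by simp [h]⟩

/-- The letters that are not erased by `τ`. -/
abbrev Surviving (τ : A → List A) : Type _ :=
  {a // τ a ≠ []}

open Classical in
/-- The morphism that removes the letters erased by `τ`. -/
noncomputable def eraseMap (τ : A → List A) (a : A) : List (Surviving τ) :=
  if h : τ a ≠ [] then [⟨a, h⟩] else []

/-- The restriction of `τ` to the letters it does not erase. -/
def survivingMap (τ : A → List A) (b : Surviving τ) : List A :=
  τ b

open Classical in
/-- The morphism obtained from `τ` by removing the erased letters and fixing the bounded ones. -/
noncomputable def tameMap (τ : A → List A) (b : Surviving τ) : List (Surviving τ) :=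
  if IsBounded τ b then [b] else wordMap (eraseMap τ) (τ b)

theorem wordMap_survivingMap_eraseMap (τ : A → List A) (w : List A) :
    wordMap (survivingMap τ) (wordMap (eraseMap τ) w) = wordMap τ w := by
  rw [wordMap_wordMap]
  refine wordMap_congr fun a _ => ?_
  by_cases h : τ a = [] <;> simp [eraseMap, survivingMap, h]

theorem IsBoundedIdempotent.semiconj (H : IsBoundedIdempotent τ) :
    Function.Semiconj (wordMap (survivingMap τ)) (wordMap (tameMap τ)) (wordMap τ) := fun w => by
  rw [wordMap_wordMap, wordMap_wordMap]
  refine wordMap_congr fun b _ => ?_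
  by_cases h : IsBounded τ b
  · simp [tameMap, h, survivingMap, H b h]
  · simp [tameMap, h, survivingMap, wordMap_survivingMap_eraseMap]

theorem IsBoundedIdempotent.isBounded_of_iterate_tameMap (H : IsBoundedIdempotent τ)
    {b : Surviving τ} {n : ℕ} (h : (wordMap (tameMap τ))^[n + 1] [b] = [b]) :
    IsBounded τ b := by
  have hτ := H.semiconj.iterate_right (n + 1) [b]
  rw [h] at hτ
  refine ⟨1, n + 2, by omega, ?_⟩
  rw [Function.iterate_succ_apply _ (n + 1)]
  simpa [survivingMap] using hτ

theorem IsBoundedIdempotent.isTame (H : IsBoundedIdempotent τ) : IsTame (tameMap τ) := by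
  have hfixed {b : Surviving τ} : IsFixed (tameMap τ) b ↔ IsBounded τ b :=
    ⟨fun h => H.isBounded_of_iterate_tameMap (h.iterate_wordMap 1),
      fun h => by simp [IsFixed, tameMap, h]⟩
  refine ⟨fun b hb => ?_, fun b n h => hfixed.2 (H.isBounded_of_iterate_tameMap h)⟩
  rw [hfixed] at hb
  obtain ⟨a, ha, hmov⟩ : ∃ a ∈ τ b, ¬ IsBounded τ a := by
    contrapose! hb
    exact H.isBounded_of_forall_mem hb
  have hsurv : τ a ≠ [] := fun h => hmov (isBounded_of_eq_nil h)
  refine ⟨⟨a, hsurv⟩, ?_, fun h => hmov (hfixed.1 h)⟩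
  simp only [tameMap, if_neg hb]
  exact mem_wordMap.2 ⟨a, ha, by simp [eraseMap, hsurv]⟩

theorem exists_le_infix_iterate (hS : S.Finite) {x : ℤ → A}
    (hx : seqLanguage x ⊆ orbitLanguage s S) (p : ℕ) {t : List A} (ht : t ∈ seqLanguage x) :
    ∃ n ≥ p, ∃ w ∈ S, t <:+: (wordMap s)^[n] w := by
  obtain ⟨M, hM⟩ := (((Set.finite_Iio p).prod hS).image
    fun nw => ((wordMap s)^[nw.1] nw.2).length).bddAbove
  obtain ⟨r, hr, htr⟩ := exists_extension_right ht (M + 1)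
  obtain ⟨n, w, hw, hn⟩ := hx htr
  refine ⟨n, ?_, w, hw, (List.prefix_append t r).isInfix.trans hn⟩
  by_contra! hlt
  have hle : ((wordMap s)^[n] w).length ≤ M := hM ⟨(n, w), ⟨hlt, hw⟩, rfl⟩
  have := hn.length_le
  simp only [List.length_append] at this
  omega

theorem finite_languagesIn_orbitLanguage [Finite A] (s : A → List A) (hS : S.Finite) :
    (languagesIn (orbitLanguage s S)).Finite := by
  obtain ⟨p, hp, H⟩ := exists_isBoundedIdempotent_powMap s
  let τ := powMap s p
  let S' := (fun nw : ℕ × List A => wordMap (eraseMap τ) ((wordMap s)^[nw.1] nw.2)) ''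
    (Set.Iio p ×ˢ S)
  have hS' : S'.Finite := ((Set.finite_Iio p).prod hS).image _
  refine ((H.isTame.finite_languagesIn hS').image
    fun K => {t | ∃ w ∈ K, t <:+: wordMap (survivingMap τ) w}).subset ?_
  rintro _ ⟨x, hx, rfl⟩
  obtain ⟨y, c, hd, hy, -, -⟩ := exists_desub (φ := survivingMap τ)
    (isFactorial_orbitLanguage (tameMap τ) S') (x := x) fun t ht => by
      obtain ⟨n, hn, w, hw, htn⟩ := exists_le_infix_iterate hS hx p ht
      obtain ⟨k, hk⟩ := Nat.exists_eq_add_one.2 (Nat.div_pos hn hp)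
      have hiter : (wordMap s)^[n] w = wordMap (survivingMap τ)
          ((wordMap (tameMap τ))^[k] (wordMap (eraseMap τ) ((wordMap s)^[n % p] w))) := by
        rw [H.semiconj.iterate_right k, wordMap_survivingMap_eraseMap,
          ← Function.iterate_succ_apply, iterate_wordMap_powMap, ← Function.iterate_add_apply,
          Nat.succ_eq_add_one, ← hk, Nat.div_add_mod]
      exact ⟨_, ⟨k, _, ⟨(n % p, w), ⟨Nat.mod_lt n hp, hw⟩, rfl⟩, List.infix_rfl⟩, hiter ▸ htn⟩
  exact ⟨_, ⟨y, hy, rfl⟩, (hd.seqLanguage_eq fun b => b.2).symm⟩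

end Reduction

section Subshift

variable {A : Type*}

theorem toList_monoidEnd (σ : Monoid.End (FreeMonoid A)) (w : FreeMonoid A) :
    FreeMonoid.toList (σ w) =
      wordMap (fun a => FreeMonoid.toList (σ (FreeMonoid.of a))) (FreeMonoid.toList w) := by
  induction w using FreeMonoid.recOn with
  | one => simp
  | of_mul a w ih => simp [ih]

theorem toList_monoidEnd_pow (σ : Monoid.End (FreeMonoid A)) (n : ℕ) (w : FreeMonoid A) :
    FreeMonoid.toList ((σ ^ n) w) =
      (wordMap fun a => FreeMonoid.toList (σ (FreeMonoid.of a)))^[n] (FreeMonoid.toList w) := by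
  induction n with
  | zero => rfl
  | succ n ih =>
    rw [Function.iterate_succ_apply', ← ih, ← toList_monoidEnd, pow_succ']
    rfl

theorem endLanguage_eq_orbitLanguage (σ : Monoid.End (FreeMonoid A)) :
    endLanguage σ = orbitLanguage (fun a => FreeMonoid.toList (σ (FreeMonoid.of a)))
      (Set.range List.singleton) := by
  ext t
  simp only [endLanguage, orbitLanguage, toList_monoidEnd_pow, Set.exists_range_iff]
  rfl

theorem Occurs.apply_eq_of_block {x y : ℤ → A} {i k : ℤ} {n : ℕ} (h : Occurs x i (block y i n))
    (hik : i ≤ k) (hk : k < i + n) : x k = y k := by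
  obtain ⟨j, rfl⟩ := Int.le.dest hik
  rw [Occurs, length_block, block, block, List.ofFn_inj] at h
  exact congrFun h ⟨j, by omega⟩

variable [TopologicalSpace A]

theorem finite_seqLanguage_substitutionShift [Finite A] [DiscreteTopology A]
    (σ : Monoid.End (FreeMonoid A)) :
    {L : Set (List A) | ∃ x ∈ (substitutionShift σ).carrier, L = seqLanguage x}.Finite := by
  have h := finite_languagesIn_orbitLanguage (fun a => FreeMonoid.toList (σ (FreeMonoid.of a)))
    (Set.finite_range (List.singleton (α := A)))
  rwa [← endLanguage_eq_orbitLanguage] at h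

theorem mem_subshift_of_seqLanguage_subset (Y : Subshift A ℤ) {x y : ℤ → A}
    (hx : x ∈ Y.carrier) (h : seqLanguage y ⊆ seqLanguage x) : y ∈ Y.carrier := by
  have hshift (N : ℕ) : ∃ i, Occurs (shift i x) (-N) (block y (-N) (N + N)) := by
    obtain ⟨j, hj⟩ := mem_seqLanguage.1 (h ⟨-N, N + N, rfl⟩)
    refine ⟨j + N, ?_⟩
    simpa [Occurs, block, shift_apply, add_assoc] using hj
  choose i hi using hshift
  refine Y.isClosed.mem_of_tendsto (b := atTop) (f := fun N => shift (i N) x) ?_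
    (Eventually.of_forall fun N => Y.mapsTo (i N) hx)
  refine tendsto_pi_nhds.2 fun k => tendsto_const_nhds.congr' ?_
  filter_upwards [eventually_gt_atTop k.natAbs] with N hN
  exact ((hi N).apply_eq_of_block (by omega) (by push_cast; omega)).symm

theorem seqLanguage_image_injective :
    Function.Injective fun Y : Subshift A ℤ => seqLanguage '' Y.carrier := by
  have hle (Y Z : Subshift A ℤ) (hYZ : seqLanguage '' Y.carrier = seqLanguage '' Z.carrier) :
      Y.carrier ⊆ Z.carrier := fun y hy => by
    obtain ⟨z, hz, hzy⟩ := hYZ.subset ⟨y, hy, rfl⟩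
    exact mem_subshift_of_seqLanguage_subset Z hz hzy.ge
  intro Y Z hYZ
  have hcarrier := (hle Y Z hYZ).antisymm (hle Z Y hYZ.symm)
  cases Y
  cases Z
  simpa using hcarrier

theorem quasiMinimal_of_finite_seqLanguage {X : Subshift A ℤ}
    (h : {L : Set (List A) | ∃ x ∈ X.carrier, L = seqLanguage x}.Finite) : QuasiMinimal X := by
  refine Set.Finite.of_finite_image (h.finite_subsets.subset ?_)
    seqLanguage_image_injective.injOn
  rintro _ ⟨Y, hY, rfl⟩ _ ⟨x, hx, rfl⟩
  exact ⟨x, hY hx, rfl⟩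

end Subshift

end SubstShift

theorem mainTheorem7 {A : Type*} [Finite A] [TopologicalSpace A] [DiscreteTopology A]
    (σ : Monoid.End (FreeMonoid A)) :
    SubstShift.QuasiMinimal (SubstShift.substitutionShift σ) ∧
      {L : Set (List A) | ∃ x ∈ (SubstShift.substitutionShift σ).carrier,
        L = SubstShift.seqLanguage x}.Finite :=
  ⟨SubstShift.quasiMinimal_of_finite_seqLanguage
      (SubstShift.finite_seqLanguage_substitutionShift σ),
    SubstShift.finite_seqLanguage_substitutionShift σ⟩
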